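/- Let $d\in\mathbb N$, $0<\alpha\le 2$, $m>0$ and $\rho:\mathbb R^d\to\mathbb C$. For $N\ge 2$ consider the Markovian symmetric $N$-component synchronization model with Lévy exponent $\rho$ and mean $m$, defined as follows. The free dynamics $x^\circ_1,\dots,x^\circ_N$ are Lévy processes in $\mathbb R^d$ (started at $0$, with independent stationary increments, stochastically continuous, and with almost surely càdlàg paths) such that $\mathsf E\,e^{i\langle\lambda,x^\circ_j(t)\rangle}=e^{t\rho(\lambda)}$ for all $t\ge0$, $\lambda\in\mathbb R^d$. Component $k$ sends messages at the times $\tau^{(k)}_n=\Delta^{(k)}_1+\dots+\Delta^{(k)}_n$, $n\ge1$, where the $\Delta^{(k)}_n$ are exponentially distributed with mean $m$. The recipient of each message is uniformly distributed over the $N-1$ components other than the sender. The initial configuration $x(0)\in(\mathbb R^d)^N$ has a law that is invariant under permutations of the components. The processes $x^\circ_j$, the intervals $\Delta^{(k)}_n$, the choices of recipients and $x(0)$ are all mutually independent. Let $0=T_0<T_1<T_2<\cdots$ be the superposition of all the message times. The process $x(t)=(x_1(t),\dots,x_N(t))$ is defined by $x(0+)=x(0)$ and $$x(t)=x(T_q+0)+\bigl(x^\circ(t)-x^\circ(T_q)\bigr),\qquad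 T_q<t\le T_{q+1},\ q\ge0,$$ and at each $T_q$, $q\ge1$, if the message sent then goes from component $j_1$ to component $j_2$, one has $x_{j_2}(T_q+0)=x_{j_1}(T_q)$ and $x_j(T_q+0)=x_j(T_q)$ for $j\ne j_2$. Assume that the free dynamics is $\alpha$-stable: for each $j$ and each $t\ge 0$ there are vectors $D_n\in\mathbb R^d$ such that for all $n\ge1$ the sum of $n$ independent copies of $U=x^\circ_j(t)$ has the law of $n^{1/\alpha}U+D_n$. Then for every $N\ge2$ and all $j\ne k$ the difference $d^{(N)}_{jk}(t)=x_j(t)-x_k(t)$ converges in law, as $t\to\infty$, to a random vector $d^{(N)}_{jk}(\infty)$, and the law of $$\frac{d^{(N)}_{jk}(\infty)}{(N-1)^{1/\alpha}}$$ is one and the same probability measure on $\mathbb R^d$ for all $N\ge2$ (it depends only on $\rho$ and $m$, and not on $N$, on $j\neq k$, or on the law of $x(0)$). Its characteristic function is $$\lambda\mapsto\frac{1}{1+\frac12\,m\,\eta(\lambda)},\qquad \eta(\lambda)=-2\,\mathrm{Re}\,\rho(\lambda).$$ -/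

import Mathlib

open MeasureTheory ProbabilityTheory Filter Topology
open scoped NNReal

noncomputable section

namespace SyncSystem

/-! ### Lévy processes and stable laws in `ℝ^d` -/

/-- A Lévy process in `ℝ^d` on `(Ω, P)`: it starts from the origin, has independent and stationary
increments and is stochastically continuous; as usual, its paths are taken to be almost surely
right-continuous with left limits. -/
structure IsLevyProcess {d : ℕ} {Ω : Type*} [MeasurableSpace Ω]
    (X : ℝ≥0 → Ω → EuclideanSpace ℝ (Fin d)) (P : Measure Ω) : Prop where
  measurable : ∀ t, Measurable (X t)
  start_zero : ∀ᵐ ω ∂P, X 0 ω = 0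
  indep_increments : HasIndepIncrements X P
  stationary_increments : ∀ s h : ℝ≥0, P.map (fun ω => X (s + h) ω - X s ω) = P.map (X h)
  stochastically_continuous : ∀ s : ℝ≥0, TendstoInMeasure P X (𝓝 s) (X s)
  cadlag : ∀ᵐ ω ∂P, ∀ t : ℝ≥0, ContinuousWithinAt (fun s => X s ω) (Set.Ici t) t ∧
    ∃ l, Tendsto (fun s => X s ω) (𝓝[<] t) (𝓝 l)

/-- `ρ` is the Lévy exponent of `X`: `E exp(i⟨lam, X t⟩) = exp(t ρ(lam))` for all `t ≥ 0`. -/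
def HasLevyExponent {d : ℕ} {Ω : Type*} [MeasurableSpace Ω]
    (X : ℝ≥0 → Ω → EuclideanSpace ℝ (Fin d)) (ρ : EuclideanSpace ℝ (Fin d) → ℂ)
    (P : Measure Ω) : Prop :=
  ∀ (t : ℝ≥0) (lam : EuclideanSpace ℝ (Fin d)),
    charFun (P.map (X t)) lam = Complex.exp (((t : ℝ) : ℂ) * ρ lam)

/-- The law `μ` is stable with index `α`: there are vectors `D n` such that, for every `n ≥ 1`,
`U₁ + ⋯ + Uₙ` has the law of `n^(1/α) U + D n`, where `U, U₁, …, Uₙ` are independent with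
law `μ`. -/
def IsStableLaw {d : ℕ} (α : ℝ) (μ : Measure (EuclideanSpace ℝ (Fin d))) : Prop :=
  ∃ D : ℕ → EuclideanSpace ℝ (Fin d), ∀ n : ℕ, 1 ≤ n →
    (Measure.pi (fun _ : Fin n => μ)).map (fun u => ∑ i, u i) =
      μ.map (fun u => (n : ℝ) ^ (1 / α) • u + D n)

/-- The process `X` is `α`-stable: every `X t` has an `α`-stable law. -/
def IsStableProcess {d : ℕ} {Ω : Type*} [MeasurableSpace Ω] (α : ℝ)
    (X : ℝ≥0 → Ω → EuclideanSpace ℝ (Fin d)) (P : Measure Ω) : Prop :=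
  ∀ t, IsStableLaw α (P.map (X t))

/-! ### The pathwise construction of the synchronized system

`gap k n` is the `n`-th interval between messages of component `k`, `recip k n` the recipient of
its `n`-th message (`n` counted from `0`), `free` a path of the free dynamics and `init` the initial
configuration. -/

/-- The time at which component `k` sends its message number `n` (counted from `0`). -/
def messageTime {N : ℕ} (gap : Fin N → ℕ → ℝ≥0) (k : Fin N) (n : ℕ) : ℝ≥0 :=
  ∑ i ∈ Finset.range (n + 1), gap k i

/-- The synchronization epochs `0 = T 0 < T 1 < T 2 < ⋯`: the superposition, in increasing order,
of the message times of all components. -/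
def epoch {N : ℕ} (gap : Fin N → ℕ → ℝ≥0) : ℕ → ℝ≥0
  | 0 => 0
  | q + 1 => sInf {s : ℝ≥0 | epoch gap q < s ∧ ∃ k n, messageTime gap k n = s}

open Classical in
/-- The synchronization map at epoch `q`: if the message sent at that time is the `n`-th message
of `k`, then `recip k n` is sent to `k`, and all other indices are fixed. -/
def syncMap {N : ℕ} (gap : Fin N → ℕ → ℝ≥0) (recip : Fin N → ℕ → Fin N) (q : ℕ) :
    Fin N → Fin N :=
  if h : ∃ p : Fin N × ℕ, messageTime gap p.1 p.2 = epoch gap q then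
    Function.update id (recip h.choose.1 h.choose.2) h.choose.1
  else id

/-- The configuration `x(T q + 0)` immediately after the `q`-th synchronization
(for `q = 0`, the initial configuration). -/
def afterSync {N d : ℕ} (free : Fin N → ℝ≥0 → EuclideanSpace ℝ (Fin d))
    (gap : Fin N → ℕ → ℝ≥0) (recip : Fin N → ℕ → Fin N)
    (init : Fin N → EuclideanSpace ℝ (Fin d)) : ℕ → Fin N → EuclideanSpace ℝ (Fin d)
  | 0 => init
  | q + 1 => fun j =>
      let i := syncMap gap recip (q + 1) j
      afterSync free gap recip init q i + (free i (epoch gap (q + 1)) - free i (epoch gap q))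

/-- The last index `q` with `T q < t` (and `0` for `t = 0`). -/
def lastSync {N : ℕ} (gap : Fin N → ℕ → ℝ≥0) (t : ℝ≥0) : ℕ :=
  sSup {q : ℕ | epoch gap q < t}

/-- The configuration `x(t)`: for `T q < t ≤ T (q + 1)` it equals
`x(T q + 0) + (x°(t) - x°(T q))`, where `x°` is the free dynamics. -/
def configuration {N d : ℕ} (free : Fin N → ℝ≥0 → EuclideanSpace ℝ (Fin d))
    (gap : Fin N → ℕ → ℝ≥0) (recip : Fin N → ℕ → Fin N)
    (init : Fin N → EuclideanSpace ℝ (Fin d)) (t : ℝ≥0) (j : Fin N) :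
    EuclideanSpace ℝ (Fin d) :=
  afterSync free gap recip init (lastSync gap t) j +
    (free j t - free j (epoch gap (lastSync gap t)))

/-! ### The Markovian symmetric model -/

/-- Names for the sources of randomness: the free motion of each component, each inter-message
interval, each choice of a recipient, and the initial configuration. -/
inductive Source (N : ℕ) : Type
  | free (j : Fin N) : Source N
  | gap (k : Fin N) (n : ℕ) : Source N
  | recip (k : Fin N) (n : ℕ) : Source N
  | init : Source N

/-- The `σ`-algebra generated by a source of randomness. -/
@[reducible] def sourceSigma {N d : ℕ} {Ω : Type*} (free : Fin N → ℝ≥0 → Ω → EuclideanSpace ℝ (Fin d))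
    (gap : Fin N → ℕ → Ω → ℝ≥0) (recip : Fin N → ℕ → Ω → Fin N)
    (init : Ω → Fin N → EuclideanSpace ℝ (Fin d)) : Source N → MeasurableSpace Ω
  | Source.free j => MeasurableSpace.comap (fun ω (t : ℝ≥0) => free j t ω) inferInstance
  | Source.gap k n => MeasurableSpace.comap (gap k n) inferInstance
  | Source.recip k n => MeasurableSpace.comap (recip k n) inferInstance
  | Source.init => MeasurableSpace.comap init inferInstance

/-- A realization on `(Ω, P)` of the Markovian symmetric `N`-component synchronization model with
Lévy exponent `ρ` and mean inter-message time `m`. -/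
structure MarkovSymmetricModel (N : ℕ) {d : ℕ} (ρ : EuclideanSpace ℝ (Fin d) → ℂ) (m : ℝ)
    {Ω : Type*} [MeasurableSpace Ω] (P : Measure Ω) where
  /-- the free dynamics of the components -/
  free : Fin N → ℝ≥0 → Ω → EuclideanSpace ℝ (Fin d)
  /-- the intervals between successive messages of each component -/
  gap : Fin N → ℕ → Ω → ℝ≥0
  /-- the recipients of the messages of each component -/
  recip : Fin N → ℕ → Ω → Fin N
  /-- the initial configuration -/
  init : Ω → Fin N → EuclideanSpace ℝ (Fin d)
  free_levy : ∀ j, IsLevyProcess (free j) P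
  free_exponent : ∀ j, HasLevyExponent (free j) ρ P
  gap_measurable : ∀ k n, Measurable (gap k n)
  /-- the intervals are exponentially distributed with mean `m` -/
  gap_law : ∀ k n, P.map (fun ω => (gap k n ω : ℝ)) = expMeasure m⁻¹
  recip_measurable : ∀ k n, Measurable (recip k n)
  /-- each recipient is uniformly distributed over the components other than the sender -/
  recip_law : ∀ k n j, j ≠ k → P.real {ω | recip k n ω = j} = 1 / ((N : ℝ) - 1)
  init_measurable : Measurable init
  /-- the initial distribution is invariant under permutations of the components -/
  init_exchangeable : ∀ π : Equiv.Perm (Fin N), P.map (fun ω j => init ω (π j)) = P.map init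
  /-- all sources of randomness are mutually independent -/
  independent : iIndep (sourceSigma free gap recip init) P

/-- The state `x_j(t)` of component `j` at time `t`. -/
def MarkovSymmetricModel.state {N d : ℕ} {ρ : EuclideanSpace ℝ (Fin d) → ℂ} {m : ℝ} {Ω : Type*}
    [MeasurableSpace Ω] {P : Measure Ω} (S : MarkovSymmetricModel N ρ m P)
    (j : Fin N) (t : ℝ≥0) (ω : Ω) : EuclideanSpace ℝ (Fin d) :=
  configuration (fun i s => S.free i s ω) (fun k n => S.gap k n ω) (fun k n => S.recip k n ω)
    (S.init ω) t j

/-- The function `η(lam) = -2 Re ρ(lam)` of a Lévy exponent `ρ`. -/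
def eta {d : ℕ} (ρ : EuclideanSpace ℝ (Fin d) → ℂ) (lam : EuclideanSpace ℝ (Fin d)) : ℝ :=
  -2 * (ρ lam).re

end SyncSystem

end

/-! Read backwards in time, the value carried by a component has a lineage: a message from `k` to
`l` sends the lineage of `l` to `k`. Two distinct lineages merge exactly when one of the two
components sends to the other. Messages arrive at rate `N / m`, and the ordered pair (sender,
recipient) is uniform among `N (N - 1)` pairs, so the merging rate is `κ = 2 / ((N - 1) m)`. After
merging the difference is zero. While the lineages are apart, the difference is driven by two
independent Lévy processes, and its characteristic function at `v` is damped by `exp (-η(v) s)` over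
a time `s`, because the characteristic function at `-v` is the conjugate of that at `v`. Started
from the value `c`, it therefore equals `κ/(κ+η) + (c - κ/(κ+η)) exp (-(κ+η) t)` at time `t`
(`mergeCurve`). Its limit is `1 / (1 + (N-1) m η / 2)`. Stability gives `η(n^(1/α) v) = n η(v)`;
with `n = N - 1`, rescaling removes `N`.

The probabilistic core is the restart at the first message (`ae_exists_isFirst_and_lintegral_step`):
the first message time is exponential with rate `N r`, the pair is uniform, the remaining
environment has the original law, and the three are independent. For a fixed environment, the
difference has a characteristic function obtained by applying linear operators on functions of
pairs, one for each epoch (`charFun_envConfig`). Exchangeability of the initial law makes the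
initial pair function constant off the diagonal. Averaging over one message preserves this form
(`sum_transfer_offDiagFun`), so the mean satisfies a scalar renewal equation (`meanFlow_renewal`),
whose only bounded solution is `mergeCurve` (`meanFlow_eq`).

Independence of environment and free motion transports this to the model (`charFun_state_sub`). The
limit law is realised explicitly as the difference of two free motions run for an independent
exponential time (`exists_limit_law`), and Lévy's continuity theorem gives the convergence. -/

noncomputable section

namespace SyncSystem

open scoped ENNReal

/-! ### The exponential law on `ℝ≥0` -/

/-- The exponential law with rate `r`, as a measure on `ℝ≥0`. -/
def expNN (r : ℝ) : Measure ℝ≥0 := (expMeasure r).map Real.toNNReal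

lemma isProbabilityMeasure_expNN {r : ℝ} (hr : 0 < r) : IsProbabilityMeasure (expNN r) := by
  have := isProbabilityMeasure_expMeasure hr
  exact Measure.isProbabilityMeasure_map (by fun_prop)

lemma lintegral_expNN (r : ℝ) {f : ℝ≥0 → ℝ≥0∞} (hf : Measurable f) :
    ∫⁻ s, f s ∂expNN r =
      ∫⁻ x in Set.Ici (0 : ℝ), ENNReal.ofReal (r * Real.exp (-(r * x))) * f x.toNNReal := by
  have hpdf : Measurable (exponentialPDF r) :=
    (measurable_exponentialPDFReal r).ennreal_ofReal
  have : expMeasure r = volume.withDensity (exponentialPDF r) := rfl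
  rw [expNN, lintegral_map hf (by fun_prop), this,
    lintegral_withDensity_eq_lintegral_mul _ hpdf (by fun_prop),
    ← lintegral_indicator measurableSet_Ici]
  refine lintegral_congr fun x => ?_
  by_cases hx : 0 ≤ x
  · simp [hx, exponentialPDF_of_nonneg hx]
  · simp [hx, exponentialPDF_of_neg (not_le.1 hx)]

lemma expNN_Ioi {r : ℝ} (hr : 0 < r) (x : ℝ≥0) :
    expNN r (Set.Ioi x) = ENNReal.ofReal (Real.exp (-(r * x))) := by
  have := isProbabilityMeasure_expMeasure hr
  have hpre : Real.toNNReal ⁻¹' Set.Ioi x = (Set.Iic (x : ℝ))ᶜ := by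
    ext y
    simp [Real.lt_toNNReal_iff_coe_lt]
  rw [expNN, Measure.map_apply (by fun_prop) measurableSet_Ioi, hpre,
    prob_compl_eq_one_sub measurableSet_Iic, ← ofReal_cdf, cdf_expMeasure_eq hr,
    if_pos x.coe_nonneg, ← ENNReal.ofReal_one, ← ENNReal.ofReal_sub _ (by simp; positivity)]
  simp

/-- Two finite measures on `ℝ≥0` with the same total mass and the same tails are equal. -/
lemma ext_of_Ioi_nnreal {μ ν : Measure ℝ≥0} [IsFiniteMeasure μ] [IsFiniteMeasure ν]
    (hu : μ Set.univ = ν Set.univ) (h : ∀ x, μ (Set.Ioi x) = ν (Set.Ioi x)) : μ = ν := by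
  refine Measure.ext_of_Iic _ _ fun a => ?_
  rw [← Set.compl_Ioi, measure_compl measurableSet_Ioi (measure_ne_top _ _),
    measure_compl measurableSet_Ioi (measure_ne_top _ _), h, hu]

/-- The exponential law is memoryless. -/
lemma expNN_memoryless {r : ℝ} (hr : 0 < r) (g : ℝ≥0) :
    ((expNN r).restrict (Set.Ioi g)).map (fun x => x - g) =
      ENNReal.ofReal (Real.exp (-(r * g))) • expNN r := by
  have := isProbabilityMeasure_expNN hr
  have : IsFiniteMeasure (ENNReal.ofReal (Real.exp (-(r * g))) • expNN r) :=
    Measure.smul_finite _ ENNReal.ofReal_ne_top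
  have hm : Measurable fun x : ℝ≥0 => x - g := by fun_prop
  refine ext_of_Ioi_nnreal ?_ fun x => ?_
  · rw [Measure.map_apply hm .univ]
    simp [expNN_Ioi hr]
  · have hset : (fun x : ℝ≥0 => x - g) ⁻¹' Set.Ioi x ∩ Set.Ioi g = Set.Ioi (x + g) := by
      ext y
      simp only [Set.mem_inter_iff, Set.mem_preimage, Set.mem_Ioi, lt_tsub_iff_right]
      exact ⟨fun h => h.1, fun h => ⟨h, lt_of_le_of_lt le_add_self h⟩⟩
    rw [Measure.map_apply hm measurableSet_Ioi,
      Measure.restrict_apply (hm measurableSet_Ioi), hset, Measure.smul_apply, expNN_Ioi hr,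
      expNN_Ioi hr, smul_eq_mul, ← ENNReal.ofReal_mul (Real.exp_nonneg _), ← Real.exp_add]
    congr 2
    push_cast
    ring

/-- Weighting an exponential law by an exponential function. -/
lemma lintegral_exp_mul_expNN {r a : ℝ} (hr : 0 < r) (ha : 0 ≤ a) {f : ℝ≥0 → ℝ≥0∞}
    (hf : Measurable f) :
    ∫⁻ s, ENNReal.ofReal (Real.exp (-(a * s))) * f s ∂expNN r =
      ENNReal.ofReal (r / (r + a)) * ∫⁻ s, f s ∂expNN (r + a) := by
  rw [lintegral_expNN _ (by fun_prop), lintegral_expNN _ hf, ← lintegral_const_mul _ (by fun_prop)]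
  refine setLIntegral_congr_fun measurableSet_Ici fun x hx => ?_
  have hx : 0 ≤ x := hx
  have hra : 0 < r + a := by positivity
  simp only [Real.coe_toNNReal _ hx]
  rw [← mul_assoc, ← mul_assoc, ← ENNReal.ofReal_mul (by positivity),
    ← ENNReal.ofReal_mul (by positivity)]
  congr 2
  rw [mul_assoc, ← Real.exp_add, ← mul_assoc, div_mul_cancel₀ _ hra.ne']
  congr 2
  ring

/-- The Laplace transform of the exponential law. -/
lemma lintegral_exp_neg_expNN {r a : ℝ} (hr : 0 < r) (ha : 0 ≤ a) :
    ∫⁻ s, ENNReal.ofReal (Real.exp (-(a * s))) ∂expNN r = ENNReal.ofReal (r / (r + a)) := by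
  have := isProbabilityMeasure_expNN (add_pos_of_pos_of_nonneg hr ha)
  simpa using lintegral_exp_mul_expNN hr ha (f := 1) measurable_one

lemma expNN_pos_ae {r : ℝ} (hr : 0 < r) : ∀ᵐ s ∂expNN r, 0 < s := by
  have := isProbabilityMeasure_expNN hr
  refine (mem_ae_iff_prob_eq_one (s := Set.Ioi 0) measurableSet_Ioi).2 ?_
  simp [expNN_Ioi hr]

lemma expNN_singleton (r : ℝ) (x : ℝ≥0) : expNN r {x} = 0 := by
  have h := lintegral_expNN r (f := Set.indicator {x} 1)
    (measurable_one.indicator (measurableSet_singleton x))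
  rw [lintegral_indicator_one (measurableSet_singleton x)] at h
  rw [h, setLIntegral_congr_fun_ae (g := 0) measurableSet_Ici]
  · simp
  · have : ∀ᵐ y : ℝ, y ≠ x := by simp [ae_iff]
    filter_upwards [this] with y hy hy0
    have hy0 : 0 ≤ y := hy0
    have : y.toNNReal ≠ x := fun h => hy (by rw [← h, Real.coe_toNNReal _ hy0])
    simp [this]

lemma expNN_Ici {r : ℝ} (hr : 0 < r) (x : ℝ≥0) :
    expNN r (Set.Ici x) = ENNReal.ofReal (Real.exp (-(r * x))) := by
  rw [← expNN_Ioi hr, ← Set.Ioi_insert, Set.insert_eq]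
  refine le_antisymm ((measure_union_le _ _).trans ?_) (measure_mono Set.subset_union_right)
  rw [expNN_singleton, zero_add]

/-! ### Sequences of independent variables with a common law -/

/-- Put an element in front of a sequence. -/
def seqCons {X : Type*} (p : X × (ℕ → X)) : ℕ → X
  | 0 => p.1
  | n + 1 => p.2 n

lemma measurable_seqCons {X : Type*} [MeasurableSpace X] :
    Measurable (seqCons : X × (ℕ → X) → ℕ → X) := by
  refine measurable_pi_iff.2 fun n => ?_
  cases n with
  | zero => exact measurable_fst
  | succ n => exact (measurable_pi_apply n).comp measurable_snd

/-- An i.i.d. sequence is unchanged in law when an independent term is put in front. This makes it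
possible to split off the first mark of a component. -/
lemma map_seqCons_prod_infinitePi {X : Type*} [MeasurableSpace X] (μ : Measure X)
    [IsProbabilityMeasure μ] :
    (μ.prod (Measure.infinitePi fun _ : ℕ => μ)).map seqCons =
      Measure.infinitePi fun _ : ℕ => μ := by
  classical
  refine Measure.eq_infinitePi _ fun s t ht => ?_
  -- Enlarging the index set to an initial segment, with `Set.univ` in the new coordinates, makes
  -- the preimage of the cylinder under `seqCons` a product.
  obtain ⟨n, hn⟩ : ∃ n, s ⊆ Finset.range (n + 1) :=
    ⟨s.sup id, fun i hi => Finset.mem_range_succ_iff.2 (Finset.le_sup (f := id) hi)⟩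
  let t' : ℕ → Set X := fun i => if i ∈ s then t i else Set.univ
  have ht' : ∀ i, MeasurableSet (t' i) := fun i => by
    by_cases hi : i ∈ s <;> simp [t', hi, ht i]
  have hpi : (s : Set ℕ).pi t = ((Finset.range (n + 1) : Finset ℕ) : Set ℕ).pi t' := by
    ext x
    simp only [Set.mem_pi, Finset.mem_coe, t']
    refine ⟨fun h i _ => ?_, fun h i hi => ?_⟩
    · split_ifs with hi
      · exact h i hi
      · trivial
    · simpa [hi] using h i (hn hi)
  have hprod : ∏ i ∈ s, μ (t i) = ∏ i ∈ Finset.range (n + 1), μ (t' i) := by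
    rw [← Finset.prod_subset hn fun i _ hi => by simp [t', hi]]
    exact Finset.prod_congr rfl fun i hi => by simp [t', hi]
  have hpre : seqCons ⁻¹' ((Finset.range (n + 1) : Finset ℕ) : Set ℕ).pi t' =
      t' 0 ×ˢ ((Finset.range n : Finset ℕ) : Set ℕ).pi fun i => t' (i + 1) := by
    ext x
    simp only [Set.mem_preimage, Set.mem_pi, Finset.coe_range, Set.mem_Iio, Set.mem_prod]
    refine ⟨fun h => ⟨h 0 (by omega), fun i hi => h (i + 1) (by omega)⟩, fun h i hi => ?_⟩
    cases i with
    | zero => exact h.1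
    | succ i => exact h.2 i (by omega)
  rw [hpi, hprod, Measure.map_apply measurable_seqCons (.pi (Set.to_countable _) fun i _ => ht' i),
    hpre, Measure.prod_prod, Measure.infinitePi_pi _ fun i _ => ht' (i + 1),
    Finset.prod_range_succ', mul_comm]

/-! ### The environment: message intervals and recipients -/

/-- The environment: for each component the sequence of its message intervals and recipients. -/
abbrev Env (N : ℕ) : Type := Fin N → ℕ → ℝ≥0 × Fin N

/-- The uniform law on the components other than `k`. -/
def unifNe {N : ℕ} (k : Fin N) : Measure (Fin N) :=
  (N - 1 : ℝ≥0∞)⁻¹ • ∑ j ∈ Finset.univ.erase k, Measure.dirac j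

/-- The law of one interval and recipient of component `k`, with rate `r`. -/
def markLaw {N : ℕ} (r : ℝ) (k : Fin N) : Measure (ℝ≥0 × Fin N) := (expNN r).prod (unifNe k)

/-- The law of the sequence of intervals and recipients of component `k`. -/
def seqLaw {N : ℕ} (r : ℝ) (k : Fin N) : Measure (ℕ → ℝ≥0 × Fin N) :=
  Measure.infinitePi fun _ => markLaw r k

/-- The law of the environment. -/
def envLaw (N : ℕ) (r : ℝ) : Measure (Env N) := Measure.pi fun k => seqLaw r k

/-- The uniform law on ordered pairs of distinct components. -/
def pairLaw (N : ℕ) : Measure (Fin N × Fin N) :=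
  (N : ℝ≥0∞)⁻¹ • ∑ k : Fin N, (unifNe k).map (Prod.mk k)

lemma lintegral_unifNe {N : ℕ} (k : Fin N) (f : Fin N → ℝ≥0∞) :
    ∫⁻ u, f u ∂unifNe k = (N - 1 : ℝ≥0∞)⁻¹ * ∑ j ∈ Finset.univ.erase k, f j := by
  simp [unifNe, lintegral_finsetSum_measure]

lemma isProbabilityMeasure_unifNe {N : ℕ} (hN : 2 ≤ N) (k : Fin N) :
    IsProbabilityMeasure (unifNe k) := by
  refine ⟨?_⟩
  have h1 : ((N - 1 : ℕ) : ℝ≥0∞) ≠ 0 := Nat.cast_ne_zero.2 (by omega)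
  have := lintegral_unifNe k 1
  simp only [Pi.one_apply, lintegral_one, Finset.sum_const, Finset.card_erase_of_mem
    (Finset.mem_univ k), Finset.card_univ, Fintype.card_fin, nsmul_eq_mul, mul_one] at this
  rw [this, ← Nat.cast_one (R := ℝ≥0∞), ← ENNReal.natCast_sub,
    ENNReal.inv_mul_cancel h1 (ENNReal.natCast_ne_top _)]
  simp

section

variable {N : ℕ} {r : ℝ}

lemma isProbabilityMeasure_markLaw (hN : 2 ≤ N) (hr : 0 < r) (k : Fin N) :
    IsProbabilityMeasure (markLaw r k) := by
  have := isProbabilityMeasure_unifNe hN k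
  have := isProbabilityMeasure_expNN hr
  unfold markLaw
  infer_instance

lemma isProbabilityMeasure_seqLaw (hN : 2 ≤ N) (hr : 0 < r) (k : Fin N) :
    IsProbabilityMeasure (seqLaw r k) := by
  have := isProbabilityMeasure_markLaw hN hr k
  unfold seqLaw
  infer_instance

lemma isProbabilityMeasure_envLaw (hN : 2 ≤ N) (hr : 0 < r) :
    IsProbabilityMeasure (envLaw N r) := by
  have := isProbabilityMeasure_seqLaw hN hr
  unfold envLaw
  infer_instance

/-- Lower the first interval of a sequence by `g`. -/
def subHead (g : ℝ≥0) (s : ℕ → ℝ≥0 × Fin N) : ℕ → ℝ≥0 × Fin N :=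
  Function.update s 0 ((s 0).1 - g, (s 0).2)

lemma measurable_subHead_uncurry :
    Measurable fun p : ℝ≥0 × (ℕ → ℝ≥0 × Fin N) => subHead p.1 p.2 := by
  refine measurable_pi_iff.2 fun n => ?_
  cases n with
  | zero => simp only [subHead, Function.update_self]; fun_prop
  | succ n => simp only [subHead, ne_eq, Nat.succ_ne_zero, not_false_eq_true,
      Function.update_of_ne]; fun_prop

lemma measurable_subHead (g : ℝ≥0) : Measurable (subHead g : (ℕ → ℝ≥0 × Fin N) → _) :=
  measurable_subHead_uncurry.comp (measurable_const.prodMk measurable_id)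

/-- Only the first interval is conditioned and lowered. Once it is split off by `seqCons`, the claim
is `expNN_memoryless` tensored with identities. -/
lemma seqLaw_memoryless (hN : 2 ≤ N) (hr : 0 < r) (k : Fin N) (g : ℝ≥0) :
    ((seqLaw r k).restrict {s | g < (s 0).1}).map (subHead g) =
      ENNReal.ofReal (Real.exp (-(r * g))) • seqLaw r k := by
  have := isProbabilityMeasure_markLaw hN hr k
  have := isProbabilityMeasure_seqLaw hN hr k
  have := isProbabilityMeasure_unifNe hN k
  have := isProbabilityMeasure_expNN hr
  have hset : MeasurableSet {s : ℕ → ℝ≥0 × Fin N | g < (s 0).1} :=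
    measurableSet_lt measurable_const (by fun_prop)
  have hcons : seqLaw r k = ((markLaw r k).prod (seqLaw r k)).map seqCons :=
    (map_seqCons_prod_infinitePi (markLaw r k)).symm
  have hpre : seqCons ⁻¹' {s : ℕ → ℝ≥0 × Fin N | g < (s 0).1} =
      (Set.Ioi g ×ˢ Set.univ) ×ˢ Set.univ := by
    ext p
    simp [seqCons]
  have hcomp : subHead g ∘ seqCons =
      seqCons ∘ Prod.map (Prod.map (fun x : ℝ≥0 => x - g) (id : Fin N → Fin N)) id := by
    funext p n
    cases n <;> simp [subHead, seqCons, Prod.map]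
  have hm : Measurable fun x : ℝ≥0 => x - g := by fun_prop
  conv_lhs => rw [hcons]
  rw [Measure.restrict_map measurable_seqCons hset, hpre,
    Measure.map_map (measurable_subHead g) measurable_seqCons, hcomp,
    ← Measure.map_map measurable_seqCons (by fun_prop), ← Measure.prod_restrict,
    Measure.restrict_univ, markLaw, ← Measure.prod_restrict, Measure.restrict_univ,
    ← Measure.map_prod_map _ _ (by fun_prop) measurable_id,
    ← Measure.map_prod_map _ _ hm measurable_id, expNN_memoryless hr, Measure.map_id,
    Measure.map_id, Measure.prod_smul_left, Measure.prod_smul_left, Measure.map_smul]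
  rw [← markLaw, ← hcons]

/-- Put a mark in front of the sequence of component `k`. -/
def insertHead (k : Fin N) (p : (ℝ≥0 × Fin N) × Env N) : Env N :=
  Function.update p.2 k (seqCons (p.1, p.2 k))

lemma measurable_insertHead (k : Fin N) : Measurable (insertHead k) := by
  refine measurable_pi_iff.2 fun j => ?_
  by_cases h : j = k
  · subst h
    simp only [insertHead, Function.update_self]
    exact measurable_seqCons.comp (by fun_prop)
  · simp only [insertHead, ne_eq, h, not_false_eq_true, Function.update_of_ne]
    fun_prop

/-- Exposes the first mark of `k` as an independent variable, so that one can condition on it in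
`lintegral_isFirst`. -/
lemma map_insertHead (hN : 2 ≤ N) (hr : 0 < r) (k : Fin N) :
    ((markLaw r k).prod (envLaw N r)).map (insertHead k) = envLaw N r := by
  have := isProbabilityMeasure_markLaw hN hr k
  have := isProbabilityMeasure_seqLaw hN hr
  have := isProbabilityMeasure_envLaw hN hr
  refine (Measure.pi_eq fun s hs => ?_).symm
  have hmeas := MeasurableSet.univ_pi hs
  rw [Measure.map_apply (measurable_insertHead k) hmeas,
    Measure.prod_apply (measurable_insertHead k hmeas)]
  have hslice : ∀ h, Prod.mk h ⁻¹' (insertHead k ⁻¹' Set.univ.pi s) =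
      Set.univ.pi (Function.update s k {x | seqCons (h, x) ∈ s k}) := by
    intro h
    ext e
    simp only [Set.mem_preimage, Set.mem_pi, Set.mem_univ, true_imp_iff, insertHead]
    refine forall_congr' fun j => ?_
    by_cases hj : j = k
    · subst hj; simp
    · simp [hj]
  have hsplit : ∀ t, ∏ j, seqLaw r j (Function.update s k t j) =
      seqLaw r k t * ∏ j ∈ Finset.univ.erase k, seqLaw r j (s j) := by
    intro t
    rw [← Finset.mul_prod_erase _ _ (Finset.mem_univ k), Function.update_self]
    congr 1
    exact Finset.prod_congr rfl fun j hj => by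
      rw [Function.update_of_ne (Finset.ne_of_mem_erase hj)]
  simp only [hslice, envLaw, Measure.pi_pi, hsplit]
  have hcons : seqLaw r k = ((markLaw r k).prod (seqLaw r k)).map seqCons :=
    (map_seqCons_prod_infinitePi (markLaw r k)).symm
  have hmk : Measurable fun h => seqLaw r k {x | seqCons (h, x) ∈ s k} :=
    measurable_measure_prodMk_left (measurable_seqCons (hs k))
  rw [lintegral_mul_const _ hmk, ← Finset.mul_prod_erase _ _ (Finset.mem_univ k)]
  congr 1
  conv_rhs => rw [hcons, Measure.map_apply measurable_seqCons (hs k),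
    Measure.prod_apply (measurable_seqCons (hs k))]
  rfl

/-- Lower the first intervals of all components other than `k` by `g`. -/
def shiftOthers (k : Fin N) (g : ℝ≥0) (e : Env N) : Env N := fun j =>
  if j = k then e j else subHead g (e j)

/-- The event and the shift act coordinatewise: component `k` contributes the factor `1`, and each
of the other `N - 1` a factor `exp (-r g)` by memorylessness. -/
lemma envLaw_memoryless (hN : 2 ≤ N) (hr : 0 < r) (k : Fin N) (g : ℝ≥0) :
    ((envLaw N r).restrict {e | ∀ j, j ≠ k → g < (e j 0).1}).map (shiftOthers k g) =
      ENNReal.ofReal (Real.exp (-(r * g))) ^ (N - 1) • envLaw N r := by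
  have := isProbabilityMeasure_seqLaw hN hr
  have hset : {e : Env N | ∀ j, j ≠ k → g < (e j 0).1} =
      Set.univ.pi fun j => if j = k then Set.univ else {s | g < (s 0).1} := by
    ext e
    simp only [Set.mem_ofPred_eq, Set.mem_pi, Set.mem_univ, true_imp_iff]
    refine forall_congr' fun j => ?_
    by_cases hj : j = k <;> simp [hj]
  have hfun : shiftOthers k g = fun (e : Env N) j =>
      (fun j => if j = k then id else subHead g) j (e j) := by
    funext e j
    by_cases hj : j = k <;> simp [shiftOthers, hj]
  have hcoord : ∀ j : Fin N, ((seqLaw r j).restrict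
      (if j = k then Set.univ else {s | g < (s 0).1})).map (if j = k then id else subHead g) =
      (if j = k then 1 else ENNReal.ofReal (Real.exp (-(r * g)))) • seqLaw r j := by
    intro j
    by_cases hj : j = k
    · simp [hj]
    · simp only [hj, if_false]
      exact seqLaw_memoryless hN hr j g
  have hfin : ∀ j : Fin N, IsFiniteMeasure
      ((if j = k then 1 else ENNReal.ofReal (Real.exp (-(r * g)))) • seqLaw r j) := fun j =>
    Measure.smul_finite _ (by split_ifs <;> simp)
  rw [hset, envLaw, Measure.restrict_pi_pi, hfun, Measure.pi_map_pi]
  · simp only [hcoord]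
    refine Measure.pi_eq fun s hs => ?_
    rw [Measure.smul_apply, Measure.pi_pi]
    simp only [Measure.smul_apply, smul_eq_mul, Finset.prod_mul_distrib]
    congr 1
    rw [← Finset.mul_prod_erase _ _ (Finset.mem_univ k), if_pos rfl, one_mul,
      Finset.prod_congr rfl fun j hj => if_neg (Finset.ne_of_mem_erase hj)]
    simp
  · intro j
    by_cases hj : j = k
    · simp only [hj, if_true]; fun_prop
    · simp only [hj, if_false]; exact (measurable_subHead g).aemeasurable

/-! ### The first message -/

/-- Component `k` is strictly the first to send a message. -/
def IsFirst (e : Env N) (k : Fin N) : Prop := ∀ j, j ≠ k → (e k 0).1 < (e j 0).1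

lemma IsFirst.unique {e : Env N} {k k' : Fin N} (h : IsFirst e k) (h' : IsFirst e k') : k = k' := by
  by_contra hne
  exact lt_asymm (h k' (Ne.symm hne)) (h' k hne)

lemma measurableSet_isFirst (k : Fin N) : MeasurableSet {e : Env N | IsFirst e k} := by
  simp only [IsFirst, Set.ofPred_forall]
  exact .iInter fun j => .iInter fun _ => measurableSet_lt (by fun_prop) (by fun_prop)

/-- The environment after the first message, sent by `k`. -/
def pop (k : Fin N) (e : Env N) : Env N := fun j =>
  if j = k then fun n => e j (n + 1) else subHead (e k 0).1 (e j)

/-- The time, sender and recipient of the first message, if it is sent by `k`, and the environment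
after it. -/
def stepAt (k : Fin N) (e : Env N) : ℝ≥0 × (Fin N × Fin N) × Env N :=
  ((e k 0).1, (k, (e k 0).2), pop k e)

lemma measurable_pop (k : Fin N) : Measurable (pop k) := by
  refine measurable_pi_iff.2 fun j => ?_
  by_cases h : j = k
  · simp only [pop, h, if_true]; fun_prop
  · simp only [pop, h, if_false]
    have : Measurable fun e : Env N => ((e k 0).1, e j) := by fun_prop
    exact measurable_subHead_uncurry.comp this

lemma measurable_stepAt (k : Fin N) : Measurable (stepAt k) := by
  unfold stepAt
  exact (by fun_prop : Measurable fun e : Env N => (e k 0).1).prodMk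
    ((by fun_prop : Measurable fun e : Env N => (k, (e k 0).2)).prodMk (measurable_pop k))

lemma isFirst_insertHead (k : Fin N) (h : ℝ≥0 × Fin N) (e : Env N) :
    IsFirst (insertHead k (h, e)) k ↔ ∀ j, j ≠ k → h.1 < (e j 0).1 := by
  refine forall_congr' fun j => forall_congr' fun hj => ?_
  simp [insertHead, hj, seqCons]

lemma stepAt_insertHead (k : Fin N) (h : ℝ≥0 × Fin N) (e : Env N) :
    stepAt k (insertHead k (h, e)) = (h.1, (k, h.2), shiftOthers k h.1 e) := by
  simp only [stepAt, insertHead, Function.update_self, seqCons, Prod.mk.injEq, true_and]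
  funext j
  by_cases hj : j = k
  · subst hj; simp [pop, shiftOthers, seqCons]
  · simp [pop, shiftOthers, hj, seqCons]

lemma measurable_shiftOthers (k : Fin N) (g : ℝ≥0) : Measurable (shiftOthers k g) := by
  refine measurable_pi_iff.2 fun j => ?_
  by_cases h : j = k
  · simp only [shiftOthers, h, if_true]; fun_prop
  · simp only [shiftOthers, h, if_false]
    exact (measurable_subHead g).comp (by fun_prop)

/-- Given the first interval `g` of `k`, the other components are all later with probability `exp
(-(N-1) r g)`, and the environment then restarts afresh. Weighting the rate `r` exponential law by
this factor gives the rate `N r` law with total mass `r / (N r) = 1 / N`. -/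
lemma lintegral_isFirst (hN : 2 ≤ N) (hr : 0 < r) (k : Fin N)
    {H : ℝ≥0 × (Fin N × Fin N) × Env N → ℝ≥0∞} (hH : Measurable H) :
    ∫⁻ e in {e | IsFirst e k}, H (stepAt k e) ∂envLaw N r =
      (N : ℝ≥0∞)⁻¹ * ∫⁻ g, ∫⁻ u, ∫⁻ e, H (g, (k, u), e) ∂envLaw N r ∂unifNe k
        ∂expNN (N * r) := by
  have := isProbabilityMeasure_markLaw hN hr k
  have := isProbabilityMeasure_envLaw hN hr
  have := isProbabilityMeasure_unifNe hN k
  have := isProbabilityMeasure_expNN hr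
  have hHk : Measurable fun p : ℝ≥0 × Fin N => ∫⁻ e, H (p.1, (k, p.2), e) ∂envLaw N r :=
    Measurable.lintegral_prod_right' (f := fun q : (ℝ≥0 × Fin N) × Env N =>
      H (q.1.1, (k, q.1.2), q.2)) (by fun_prop)
  have hcast : ((N - 1 : ℕ) : ℝ) = N - 1 := by rw [Nat.cast_sub (by omega)]; simp
  have h1 : (1 : ℝ) ≤ N := by exact_mod_cast (by omega : 1 ≤ N)
  have hmeas : Measurable ({e | IsFirst e k}.indicator fun e => H (stepAt k e)) :=
    (hH.comp (measurable_stepAt k)).indicator (measurableSet_isFirst k)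
  have hinner : ∀ h : ℝ≥0 × Fin N,
      ∫⁻ e, {e | IsFirst e k}.indicator (fun e => H (stepAt k e)) (insertHead k (h, e))
        ∂envLaw N r =
      ENNReal.ofReal (Real.exp (-(((N - 1) * r) * h.1))) *
        ∫⁻ e, H (h.1, (k, h.2), e) ∂envLaw N r := by
    intro h
    have hA : MeasurableSet {e : Env N | ∀ j, j ≠ k → h.1 < (e j 0).1} := by
      simp only [Set.ofPred_forall]
      exact .iInter fun j => .iInter fun _ => measurableSet_lt (by fun_prop) (by fun_prop)
    have : ∀ e, {e | IsFirst e k}.indicator (fun e => H (stepAt k e)) (insertHead k (h, e)) =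
        {e : Env N | ∀ j, j ≠ k → h.1 < (e j 0).1}.indicator
          (fun e => H (h.1, (k, h.2), shiftOthers k h.1 e)) e := by
      intro e
      simp only [Set.indicator, Set.mem_ofPred_eq, isFirst_insertHead, stepAt_insertHead]
    simp only [this]
    rw [lintegral_indicator hA,
      ← lintegral_map (f := fun e => H (h.1, (k, h.2), e)) (by fun_prop)
        (measurable_shiftOthers k h.1), envLaw_memoryless hN hr, lintegral_smul_measure,
      smul_eq_mul, ← ENNReal.ofReal_pow (Real.exp_nonneg _), ← Real.exp_nat_mul, hcast]
    congr 4
    ring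
  have hN0 : (N : ℝ) ≠ 0 := by positivity
  have hfin : ENNReal.ofReal (r / (r + (N - 1) * r)) = (N : ℝ≥0∞)⁻¹ := by
    rw [show r / (r + (N - 1) * r) = ((N : ℝ))⁻¹ by
      rw [show r + (N - 1) * r = N * r by ring]; field_simp,
      ENNReal.ofReal_inv_of_pos (by positivity), ENNReal.ofReal_natCast]
  rw [← lintegral_indicator (measurableSet_isFirst k), ← map_insertHead hN hr k,
    lintegral_map hmeas (measurable_insertHead k), map_insertHead hN hr k,
    lintegral_prod (fun q => {e | IsFirst e k}.indicator (fun e => H (stepAt k e))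
      (insertHead k q)) (hmeas.comp (measurable_insertHead k)).aemeasurable]
  simp only [hinner]
  rw [markLaw, lintegral_prod _ (by fun_prop)]
  simp only
  have hswap : ∀ g : ℝ≥0, ∫⁻ u, ENNReal.ofReal (Real.exp (-((N - 1) * r * g))) *
      ∫⁻ e, H (g, (k, u), e) ∂envLaw N r ∂unifNe k =
      ENNReal.ofReal (Real.exp (-((N - 1) * r * g))) *
      ∫⁻ u, ∫⁻ e, H (g, (k, u), e) ∂envLaw N r ∂unifNe k := fun g =>
    lintegral_const_mul _ (hHk.comp (by fun_prop : Measurable fun u => (g, u)))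
  simp only [hswap]
  rw [lintegral_exp_mul_expNN hr (by nlinarith)
    (Measurable.lintegral_prod_right' (ν := unifNe k) hHk), hfin]
  congr 3
  ring

lemma lintegral_pairLaw (f : Fin N × Fin N → ℝ≥0∞) :
    ∫⁻ p, f p ∂pairLaw N = (N : ℝ≥0∞)⁻¹ * ∑ k, ∫⁻ u, f (k, u) ∂unifNe k := by
  rw [pairLaw, lintegral_smul_measure, lintegral_finsetSum_measure, smul_eq_mul]
  congr 1
  exact Finset.sum_congr rfl fun k _ => lintegral_map (by fun_prop) (by fun_prop)

end

/-! ### The regeneration of the environment at the first message. -/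

section

variable {N : ℕ} [NeZero N] {r : ℝ}

open Classical in
/-- The first component to send a message. -/
def first (e : Env N) : Fin N := if h : ∃ k, IsFirst e k then h.choose else 0

lemma IsFirst.first_eq {e : Env N} {k : Fin N} (h : IsFirst e k) : first e = k := by
  have hex : ∃ k, IsFirst e k := ⟨k, h⟩
  rw [first, dif_pos hex]
  exact hex.choose_spec.unique h

/-- The time, sender and recipient of the first message, and the environment after it. -/
def step (e : Env N) : ℝ≥0 × (Fin N × Fin N) × Env N := stepAt (first e) e

lemma measurable_first : Measurable (first : Env N → Fin N) := by
  refine measurable_to_countable' fun k => ?_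
  have hno : MeasurableSet {e : Env N | ∀ j, ¬ IsFirst e j} := by
    simp only [Set.ofPred_forall]
    exact .iInter fun j => (measurableSet_isFirst j).compl
  -- `0` is also the default value of `first` when no component is strictly first, so its fibre has
  -- an extra piece.
  by_cases hk : k = 0
  · have : first ⁻¹' {k} = {e : Env N | IsFirst e k} ∪ {e : Env N | ∀ j, ¬ IsFirst e j} := by
      ext e
      simp only [Set.mem_preimage, Set.mem_singleton_iff, Set.mem_union, Set.mem_ofPred_eq]
      by_cases h : ∃ j, IsFirst e j
      · obtain ⟨j, hj⟩ := h
        rw [hj.first_eq]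
        exact ⟨fun h => .inl (h ▸ hj), fun h => h.elim (hj.unique ·) fun h => (h j hj).elim⟩
      · have : first e = 0 := dif_neg h
        simp only [this, hk, true_iff]
        exact .inr (not_exists.1 h)
    rw [this]
    exact (measurableSet_isFirst k).union hno
  · have : first ⁻¹' {k} = {e : Env N | IsFirst e k} := by
      ext e
      refine ⟨fun h => ?_, fun h => h.first_eq⟩
      by_cases hex : ∃ j, IsFirst e j
      · obtain ⟨j, hj⟩ := hex
        have h : first e = k := h
        rw [hj.first_eq] at h
        exact h ▸ hj
      · have h0 : first e = 0 := dif_neg hex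
        exact absurd (h0.symm.trans h).symm hk
    rw [this]
    exact measurableSet_isFirst k

/-- A family of measurable functions evaluated at a measurable index from a countable type. -/
lemma measurable_eval_index {X ι Y : Type*} [MeasurableSpace X] [MeasurableSpace Y]
    [MeasurableSpace ι] [Countable ι] [MeasurableSingletonClass ι] {f : ι → X → Y} {i : X → ι}
    (hf : ∀ k, Measurable (f k)) (hi : Measurable i) : Measurable fun x => f (i x) x :=
  (measurable_from_prod_countable_left (f := fun p : X × ι => f p.2 p.1) hf).comp
    (measurable_id.prodMk hi)

lemma measurable_step : Measurable (step : Env N → _) :=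
  measurable_eval_index measurable_stepAt measurable_first

lemma isProbabilityMeasure_pairLaw (hN : 2 ≤ N) : IsProbabilityMeasure (pairLaw N) := by
  have := isProbabilityMeasure_unifNe hN
  refine ⟨?_⟩
  have := lintegral_pairLaw (N := N) 1
  simp only [Pi.one_apply, lintegral_one, measure_univ, Finset.sum_const, Finset.card_univ,
    Fintype.card_fin, nsmul_eq_mul, mul_one] at this
  rw [this, ENNReal.inv_mul_cancel (by simp [NeZero.ne]) (by simp)]

/-- The events `IsFirst e k` are disjoint, each of mass `1 / N`, hence cover almost everything.
Summing `lintegral_isFirst` over them gives the product law of the first message and the environment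
after it. -/
lemma ae_exists_isFirst_and_lintegral_step (hN : 2 ≤ N) (hr : 0 < r) :
    (∀ᵐ e ∂envLaw N r, ∃ k, IsFirst e k) ∧
    (envLaw N r).map step = (expNN (N * r)).prod ((pairLaw N).prod (envLaw N r)) := by
  have := isProbabilityMeasure_envLaw hN hr
  have := isProbabilityMeasure_unifNe hN
  have := isProbabilityMeasure_pairLaw hN
  have hN0 : (0 : ℝ) < N := by exact_mod_cast (by omega : 0 < N)
  have := isProbabilityMeasure_expNN (mul_pos hN0 hr)
  have hunion : MeasurableSet (⋃ k : Fin N, {e | IsFirst e k}) :=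
    .iUnion fun k => measurableSet_isFirst k
  have hdisj : Pairwise (Function.onFun Disjoint fun k : Fin N => {e | IsFirst e k}) :=
    fun k k' hne => Set.disjoint_left.2 fun e h h' => hne (h.unique h')
  have hprob : ∀ k : Fin N, envLaw N r {e | IsFirst e k} = (N : ℝ≥0∞)⁻¹ := by
    intro k
    have := lintegral_isFirst hN hr k (H := 1) measurable_one
    simpa using this
  have hae : ∀ᵐ e ∂envLaw N r, e ∈ ⋃ k : Fin N, {e | IsFirst e k} := by
    refine (mem_ae_iff_prob_eq_one hunion).2 ?_
    rw [measure_iUnion hdisj fun k => measurableSet_isFirst k]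
    simp only [hprob, tsum_fintype, Finset.sum_const, Finset.card_univ, Fintype.card_fin,
      nsmul_eq_mul]
    exact ENNReal.mul_inv_cancel (by simp [NeZero.ne]) (by simp)
  refine ⟨by simpa using hae, Measure.ext_of_lintegral _ fun H hH => ?_⟩
  have hHk : ∀ k : Fin N, Measurable fun p : ℝ≥0 × Fin N =>
      ∫⁻ e, H (p.1, (k, p.2), e) ∂envLaw N r := fun k =>
    Measurable.lintegral_prod_right' (f := fun q : (ℝ≥0 × Fin N) × Env N =>
      H (q.1.1, (k, q.1.2), q.2)) (by fun_prop)
  rw [lintegral_map hH measurable_step, lintegral_prod _ hH.aemeasurable]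
  have hinner : ∀ g, ∫⁻ q, H (g, q) ∂(pairLaw N).prod (envLaw N r) =
      (N : ℝ≥0∞)⁻¹ * ∑ k, ∫⁻ u, ∫⁻ e, H (g, (k, u), e) ∂envLaw N r ∂unifNe k := by
    intro g
    rw [lintegral_prod _ (by fun_prop), lintegral_pairLaw]
  simp only [hinner]
  rw [lintegral_const_mul _ (Finset.measurable_sum _ fun k _ =>
      Measurable.lintegral_prod_right' (ν := unifNe k) (hHk k)),
    lintegral_finsetSum _ fun k _ => Measurable.lintegral_prod_right' (ν := unifNe k) (hHk k),
    Finset.mul_sum]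
  simp only [← lintegral_isFirst hN hr _ hH]
  conv_lhs => rw [← Measure.restrict_eq_self_of_ae_mem hae]
  rw [lintegral_iUnion (fun k => measurableSet_isFirst k) hdisj, tsum_fintype]
  refine Finset.sum_congr rfl fun k _ => ?_
  refine setLIntegral_congr_fun (measurableSet_isFirst k) fun e he => ?_
  simp only [step, IsFirst.first_eq he]

end

section

variable {N : ℕ} [NeZero N] {r : ℝ}

/-! ### Epochs of the environment -/

/-- The time of the first message. -/
def firstTime (e : Env N) : ℝ≥0 := (step e).1

/-- The sender and the recipient of the first message. -/
def firstPair (e : Env N) : Fin N × Fin N := (step e).2.1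

/-- The environment after the first message. -/
def nextEnv (e : Env N) : Env N := (step e).2.2

/-- The synchronization map for a message from `p.1` to `p.2`. -/
def redirect {N : ℕ} (p : Fin N × Fin N) : Fin N → Fin N := Function.update id p.2 p.1

/-- The synchronization epochs, defined through the successive environments. -/
def envEpoch : ℕ → Env N → ℝ≥0
  | 0, _ => 0
  | q + 1, e => firstTime e + envEpoch q (nextEnv e)

/-- In every successive environment there is a unique first message, at a positive time, and the
epochs tend to infinity. -/
structure IsRegular (e : Env N) : Prop where
  pos : ∀ q, 0 < firstTime (nextEnv^[q] e)
  isFirst : ∀ q, IsFirst (nextEnv^[q] e) (first (nextEnv^[q] e))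
  tendsto : Tendsto (fun q => envEpoch q e) atTop atTop

lemma measurable_firstTime : Measurable (firstTime : Env N → ℝ≥0) := measurable_step.fst

lemma measurable_firstPair : Measurable (firstPair : Env N → Fin N × Fin N) :=
  measurable_step.snd.fst

lemma measurable_nextEnv : Measurable (nextEnv : Env N → Env N) := measurable_step.snd.snd

lemma measurable_envEpoch (q : ℕ) : Measurable (envEpoch q : Env N → ℝ≥0) := by
  induction q with
  | zero => exact measurable_const
  | succ q ih => exact measurable_firstTime.add (ih.comp measurable_nextEnv)

lemma envEpoch_succ (q : ℕ) (e : Env N) :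
    envEpoch (q + 1) e = envEpoch q e + firstTime (nextEnv^[q] e) := by
  induction q generalizing e with
  | zero => simp [envEpoch]
  | succ q ih =>
    rw [envEpoch, ih (nextEnv e), envEpoch, add_assoc, Function.iterate_succ_apply]

lemma IsRegular.next {e : Env N} (h : IsRegular e) : IsRegular (nextEnv e) where
  pos q := by simpa using h.pos (q + 1)
  isFirst q := by simpa using h.isFirst (q + 1)
  tendsto := by
    have h1 := (tendsto_add_atTop_iff_nat 1).2 h.tendsto
    rw [tendsto_atTop_atTop] at h1 ⊢
    intro b
    obtain ⟨i, hi⟩ := h1 (firstTime e + b)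
    exact ⟨i, fun a ha => le_of_add_le_add_left (hi a ha)⟩

lemma IsRegular.firstTime_pos {e : Env N} (h : IsRegular e) : 0 < firstTime e := h.pos 0

lemma IsRegular.isFirst_first {e : Env N} (h : IsRegular e) : IsFirst e (first e) := h.isFirst 0

lemma IsRegular.strictMono {e : Env N} (h : IsRegular e) :
    StrictMono fun q => envEpoch q e := by
  refine strictMono_nat_of_lt_succ fun q => ?_
  rw [envEpoch_succ]
  exact lt_add_of_pos_right _ (h.pos q)

/-! ### Message times of the next environment -/

lemma sum_subHead {N : ℕ} (s : ℕ → ℝ≥0 × Fin N) {g : ℝ≥0} (hg : g ≤ (s 0).1) (n : ℕ) :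
    ∑ i ∈ Finset.range (n + 1), (s i).1 =
      g + ∑ i ∈ Finset.range (n + 1), (subHead g s i).1 := by
  rw [Finset.sum_range_succ', Finset.sum_range_succ']
  simp only [subHead, ne_eq, Nat.succ_ne_zero, not_false_eq_true, Function.update_of_ne,
    Function.update_self]
  rw [add_left_comm, add_tsub_cancel_of_le hg]

lemma messageTime_first (e : Env N) :
    messageTime (fun k n => (e k n).1) (first e) 0 = firstTime e := by
  simp [messageTime, firstTime, step, stepAt]

lemma messageTime_first_succ (e : Env N) (n : ℕ) :
    messageTime (fun k n => (e k n).1) (first e) (n + 1) =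
      firstTime e + messageTime (fun k n => (nextEnv e k n).1) (first e) n := by
  rw [messageTime, Finset.sum_range_succ', add_comm]
  simp [messageTime, firstTime, nextEnv, step, stepAt, pop]

lemma messageTime_of_ne_first {e : Env N} (h : IsFirst e (first e)) {j : Fin N} (hj : j ≠ first e)
    (n : ℕ) : messageTime (fun k n => (e k n).1) j n =
      firstTime e + messageTime (fun k n => (nextEnv e k n).1) j n := by
  have := sum_subHead (e j) (h j hj).le n
  simpa [messageTime, firstTime, nextEnv, step, stepAt, pop, hj] using this

/-- The index, after the first message, of a message of the next environment. -/
def liftIndex (e : Env N) (p : Fin N × ℕ) : Fin N × ℕ :=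
  if p.1 = first e then (p.1, p.2 + 1) else p

lemma messageTime_liftIndex {e : Env N} (h : IsFirst e (first e)) (p : Fin N × ℕ) :
    messageTime (fun k n => (e k n).1) (liftIndex e p).1 (liftIndex e p).2 =
      firstTime e + messageTime (fun k n => (nextEnv e k n).1) p.1 p.2 := by
  obtain ⟨j, n⟩ := p
  by_cases hj : j = first e
  · subst hj
    simpa [liftIndex] using messageTime_first_succ e n
  · simpa [liftIndex, hj] using messageTime_of_ne_first h hj n

lemma snd_liftIndex (e : Env N) (p : Fin N × ℕ) :
    (e (liftIndex e p).1 (liftIndex e p).2).2 = (nextEnv e p.1 p.2).2 := by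
  obtain ⟨j, n⟩ := p
  by_cases hj : j = first e
  · simp [liftIndex, hj, nextEnv, step, stepAt, pop]
  · cases n <;> simp [liftIndex, hj, nextEnv, step, stepAt, pop, subHead]

lemma fst_liftIndex (e : Env N) (p : Fin N × ℕ) : (liftIndex e p).1 = p.1 := by
  unfold liftIndex
  split_ifs <;> rfl

lemma eq_first_or_exists_liftIndex (e : Env N) (p : Fin N × ℕ) :
    p = (first e, 0) ∨ ∃ p', p = liftIndex e p' := by
  obtain ⟨j, n⟩ := p
  by_cases hj : j = first e
  · cases n with
    | zero => exact .inl (by rw [hj])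
    | succ n => exact .inr ⟨(j, n), by simp [liftIndex, hj]⟩
  · exact .inr ⟨(j, n), by simp [liftIndex, hj]⟩

lemma IsFirst.firstTime_le {e : Env N} (h : IsFirst e (first e)) (j : Fin N) :
    firstTime e ≤ (e j 0).1 := by
  by_cases hj : j = first e
  · rw [hj]; exact le_rfl
  · exact (h j hj).le

lemma firstTime_le_messageTime {e : Env N} (h : IsFirst e (first e)) (p : Fin N × ℕ) :
    firstTime e ≤ messageTime (fun k n => (e k n).1) p.1 p.2 := by
  refine (h.firstTime_le p.1).trans ?_
  exact Finset.single_le_sum (f := fun i => (e p.1 i).1) (fun _ _ => zero_le)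
    (Finset.mem_range.2 (Nat.succ_pos _))

/-- Apart from the first message, the message times are those of the next environment delayed by
`firstTime e` (via `liftIndex`). The superposition thus restarts, and induction shows that the
recursive epochs enumerate it. -/
lemma IsRegular.isLeast {e : Env N} (h : IsRegular e) (q : ℕ) :
    IsLeast {s : ℝ≥0 | envEpoch q e < s ∧ ∃ k n, messageTime (fun k n => (e k n).1) k n = s}
      (envEpoch (q + 1) e) := by
  induction q generalizing e with
  | zero =>
    refine ⟨⟨by simpa [envEpoch] using h.firstTime_pos, first e, 0, ?_⟩, ?_⟩
    · simp [messageTime_first, envEpoch]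
    · rintro s ⟨-, k, n, rfl⟩
      simpa [envEpoch] using firstTime_le_messageTime h.isFirst_first (k, n)
  | succ q ih =>
    obtain ⟨⟨h1, k, n, h2⟩, h3⟩ := ih h.next
    refine ⟨⟨?_, (liftIndex e (k, n)).1, (liftIndex e (k, n)).2, ?_⟩, ?_⟩
    · exact add_lt_add_right h1 _
    · rw [messageTime_liftIndex h.isFirst_first, h2]
      rfl
    · rintro s ⟨hs, k, n, rfl⟩
      rw [envEpoch] at hs
      rcases eq_first_or_exists_liftIndex e (k, n) with hp | ⟨p', hp⟩
      · rw [(Prod.mk.inj hp).1, (Prod.mk.inj hp).2, messageTime_first] at hs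
        exact absurd hs (not_lt.2 le_self_add)
      · have hm := messageTime_liftIndex h.isFirst_first p'
        rw [← hp] at hm
        simp only at hm
        rw [hm] at hs ⊢
        exact add_le_add_right (h3 ⟨lt_of_add_lt_add_left hs, p'.1, p'.2, rfl⟩) _

lemma IsRegular.epoch_eq {e : Env N} (h : IsRegular e) (q : ℕ) :
    epoch (fun k n => (e k n).1) q = envEpoch q e := by
  induction q with
  | zero => rfl
  | succ q ih => rw [epoch, ih, (h.isLeast q).csInf_eq]

/-- Uniqueness of the message sent at an epoch is what makes the arbitrary choice in `syncMap`
harmless. -/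
lemma IsRegular.exists_index {e : Env N} (h : IsRegular e) (q : ℕ) :
    ∃ p : Fin N × ℕ,
      (∀ p' : Fin N × ℕ, messageTime (fun k n => (e k n).1) p'.1 p'.2 = envEpoch (q + 1) e ↔
        p' = p) ∧ (p.1, (e p.1 p.2).2) = firstPair (nextEnv^[q] e) := by
  induction q generalizing e with
  | zero =>
    refine ⟨(first e, 0), fun p' => ⟨fun hp => ?_, ?_⟩, ?_⟩
    · rcases eq_first_or_exists_liftIndex e p' with rfl | ⟨p'', rfl⟩
      · rfl
      · rw [messageTime_liftIndex h.isFirst_first] at hp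
        have h0 := firstTime_le_messageTime h.next.isFirst_first p''
        have h1 := h.next.firstTime_pos
        simp only [envEpoch, add_zero, add_eq_left] at hp
        rw [hp] at h0
        exact absurd h1 (not_lt.2 h0)
    · rintro rfl
      simp [messageTime_first, envEpoch]
    · simp [firstPair, step, stepAt]
  | succ q ih =>
    obtain ⟨p, hp, hpair⟩ := ih h.next
    refine ⟨liftIndex e p, fun p' => ⟨fun hp' => ?_, ?_⟩, ?_⟩
    · rcases eq_first_or_exists_liftIndex e p' with rfl | ⟨p'', rfl⟩
      · simp only [messageTime_first, envEpoch, left_eq_add, add_eq_zero] at hp'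
        exact absurd hp'.1 h.next.firstTime_pos.ne'
      · rw [messageTime_liftIndex h.isFirst_first, envEpoch, add_right_inj, hp] at hp'
        rw [hp']
    · rintro rfl
      rw [messageTime_liftIndex h.isFirst_first, envEpoch, (hp p).2 rfl]
    · rw [snd_liftIndex, fst_liftIndex, hpair, Function.iterate_succ_apply]

lemma IsRegular.syncMap_eq {e : Env N} (h : IsRegular e) (q : ℕ) :
    syncMap (fun k n => (e k n).1) (fun k n => (e k n).2) (q + 1) =
      redirect (firstPair (nextEnv^[q] e)) := by
  obtain ⟨p, hp, hpair⟩ := h.exists_index q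
  have hex : ∃ p : Fin N × ℕ, messageTime (fun k n => (e k n).1) p.1 p.2 =
      epoch (fun k n => (e k n).1) (q + 1) := ⟨p, by rw [h.epoch_eq]; exact (hp p).2 rfl⟩
  have hch : hex.choose = p := (hp _).1 (hex.choose_spec.trans (h.epoch_eq _))
  rw [syncMap, dif_pos hex, hch, ← hpair, redirect]

/-! ### Regularity holds almost surely -/

lemma map_step (hN : 2 ≤ N) (hr : 0 < r) :
    (envLaw N r).map step = (expNN (N * r)).prod ((pairLaw N).prod (envLaw N r)) :=
  (ae_exists_isFirst_and_lintegral_step hN hr).2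

lemma measurePreserving_nextEnv (hN : 2 ≤ N) (hr : 0 < r) :
    MeasurePreserving nextEnv (envLaw N r) (envLaw N r) := by
  have := isProbabilityMeasure_envLaw hN hr
  have := isProbabilityMeasure_pairLaw hN
  have hN0 : (0 : ℝ) < N := by exact_mod_cast (by omega : 0 < N)
  have := isProbabilityMeasure_expNN (mul_pos hN0 hr)
  refine ⟨measurable_nextEnv, ?_⟩
  have : (nextEnv : Env N → Env N) = Prod.snd ∘ Prod.snd ∘ step := rfl
  rw [this, ← Measure.map_map (by fun_prop) (measurable_snd.comp measurable_step),
    ← Measure.map_map (by fun_prop) measurable_step, map_step hN hr, Measure.map_snd_prod,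
    measure_univ, one_smul, Measure.map_snd_prod, measure_univ, one_smul]

lemma measurePreserving_firstTime (hN : 2 ≤ N) (hr : 0 < r) :
    MeasurePreserving firstTime (envLaw N r) (expNN (N * r)) := by
  have := isProbabilityMeasure_envLaw hN hr
  have := isProbabilityMeasure_pairLaw hN
  refine ⟨measurable_firstTime, ?_⟩
  have : (firstTime : Env N → ℝ≥0) = Prod.fst ∘ step := rfl
  rw [this, ← Measure.map_map (by fun_prop) measurable_step, map_step hN hr,
    Measure.map_fst_prod, measure_univ, one_smul]

/-- By the restart property `envEpoch q` is a sum of `q` independent exponential times of rate `N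
r`; this Laplace transform serves to exclude explosion. -/
lemma lintegral_exp_neg_envEpoch (hN : 2 ≤ N) (hr : 0 < r) (q : ℕ) :
    ∫⁻ e, ENNReal.ofReal (Real.exp (-envEpoch q e)) ∂envLaw N r =
      ENNReal.ofReal (N * r / (N * r + 1)) ^ q := by
  have := isProbabilityMeasure_envLaw hN hr
  have := isProbabilityMeasure_pairLaw hN
  have hN0 : (0 : ℝ) < N := by exact_mod_cast (by omega : 0 < N)
  have := isProbabilityMeasure_expNN (mul_pos hN0 hr)
  induction q with
  | zero => simp [envEpoch]
  | succ q ih =>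
    have hT := measurable_envEpoch (N := N) q
    have hT1 : Measurable fun e : Env N => ENNReal.ofReal (Real.exp (-envEpoch q e)) := by fun_prop
    have : ∀ e : Env N, ENNReal.ofReal (Real.exp (-envEpoch (q + 1) e)) =
        (fun x : ℝ≥0 × (Fin N × Fin N) × Env N => ENNReal.ofReal (Real.exp (-x.1)) *
          ENNReal.ofReal (Real.exp (-envEpoch q x.2.2))) (step e) := by
      intro e
      simp only
      rw [← ENNReal.ofReal_mul (Real.exp_nonneg _), ← Real.exp_add, envEpoch, NNReal.coe_add,
        neg_add]
      rfl
    simp only [this]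
    rw [← lintegral_map (f := fun x : ℝ≥0 × (Fin N × Fin N) × Env N =>
        ENNReal.ofReal (Real.exp (-x.1)) * ENNReal.ofReal (Real.exp (-envEpoch q x.2.2)))
        (by fun_prop) measurable_step, map_step hN hr, lintegral_prod_mul
        (f := fun x : ℝ≥0 => ENNReal.ofReal (Real.exp (-x)))
        (g := fun y : (Fin N × Fin N) × Env N => ENNReal.ofReal (Real.exp (-envEpoch q y.2)))
        (by fun_prop) (by fun_prop)]
    have h2 : ∫⁻ y, ENNReal.ofReal (Real.exp (-envEpoch q y.2)) ∂(pairLaw N).prod (envLaw N r) =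
        ∫⁻ e, ENNReal.ofReal (Real.exp (-envEpoch q e)) ∂envLaw N r := by
      rw [← lintegral_map (f := fun e => ENNReal.ofReal (Real.exp (-envEpoch q e))) hT1
        measurable_snd, Measure.map_snd_prod, measure_univ, one_smul]
    have h3 := lintegral_exp_neg_expNN (mul_pos hN0 hr) zero_le_one
    simp only [one_mul] at h3
    rw [h2, ih, h3, pow_succ']

lemma ae_isRegular (hN : 2 ≤ N) (hr : 0 < r) : ∀ᵐ e ∂envLaw N r, IsRegular e := by
  have hN0 : (0 : ℝ) < N := by exact_mod_cast (by omega : 0 < N)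
  have hpres := measurePreserving_nextEnv (N := N) hN hr
  have hiter := fun q => (hpres.iterate q).quasiMeasurePreserving.tendsto_ae
  have h1 : ∀ᵐ e ∂envLaw N r, ∀ q, 0 < firstTime (nextEnv^[q] e) := ae_all_iff.2 fun q =>
    (hiter q).eventually ((measurePreserving_firstTime hN hr).quasiMeasurePreserving.tendsto_ae.eventually
      (expNN_pos_ae (mul_pos hN0 hr)))
  have h2 : ∀ᵐ e ∂envLaw N r, ∀ q, IsFirst (nextEnv^[q] e) (first (nextEnv^[q] e)) := by
    refine ae_all_iff.2 fun q =>
      (hiter q).eventually (p := fun e => IsFirst e (first e)) ?_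
    filter_upwards [(ae_exists_isFirst_and_lintegral_step (N := N) hN hr).1] with e he
    obtain ⟨k, hk⟩ := he
    rwa [hk.first_eq]
  -- The integral of the infimum is at most `(N r / (N r + 1)) ^ q` for every `q`, hence zero. A
  -- vanishing infimum means that the epochs are unbounded.
  have h3 : ∀ᵐ e ∂envLaw N r, ⨅ q, ENNReal.ofReal (Real.exp (-envEpoch q e)) = 0 := by
    have hm : ∀ q, Measurable fun e : Env N => ENNReal.ofReal (Real.exp (-envEpoch q e)) :=
      fun q => by have := measurable_envEpoch (N := N) q; fun_prop
    refine (lintegral_eq_zero_iff (Measurable.iInf hm)).1 (le_antisymm ?_ zero_le)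
    have hlt : ENNReal.ofReal (N * r / (N * r + 1)) < 1 := by
      rw [ENNReal.ofReal_lt_one, div_lt_one (by positivity)]
      linarith
    refine ge_of_tendsto' (ENNReal.tendsto_pow_atTop_nhds_zero_of_lt_one hlt) fun q => ?_
    rw [← lintegral_exp_neg_envEpoch hN hr]
    exact lintegral_mono fun e => iInf_le _ q
  filter_upwards [h1, h2, h3] with e he1 he2 he3
  refine ⟨he1, he2, ?_⟩
  have hmono : Monotone fun q => envEpoch q e :=
    monotone_nat_of_le_succ fun q => by rw [envEpoch_succ]; exact le_self_add
  refine tendsto_atTop_atTop_of_monotone hmono fun b => ?_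
  have : ⨅ q, ENNReal.ofReal (Real.exp (-envEpoch q e)) < ENNReal.ofReal (Real.exp (-b)) := by
    rw [he3]
    exact ENNReal.ofReal_pos.2 (Real.exp_pos _)
  obtain ⟨q, hq⟩ := iInf_lt_iff.1 this
  rw [ENNReal.ofReal_lt_ofReal_iff (Real.exp_pos _), Real.exp_lt_exp, neg_lt_neg_iff] at hq
  exact ⟨q, by exact_mod_cast hq.le⟩

/-- The index of the last epoch before time `t`. -/
def envLast (e : Env N) (t : ℝ≥0) : ℕ := sSup {q : ℕ | envEpoch q e < t}

lemma IsRegular.lastSync_eq {e : Env N} (h : IsRegular e) (t : ℝ≥0) :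
    lastSync (fun k n => (e k n).1) t = envLast e t := by
  simp only [lastSync, envLast, h.epoch_eq]

lemma IsRegular.envLast_of_le {e : Env N} (h : IsRegular e) {t : ℝ≥0} (ht : t ≤ firstTime e) :
    envLast e t = 0 := by
  have : ∀ q ∈ {q : ℕ | envEpoch q e < t}, q ≤ 0 := by
    intro q hq
    by_contra hq0
    have h1 : envEpoch 1 e ≤ envEpoch q e := h.strictMono.monotone (by omega)
    simp only [envEpoch, add_zero] at h1
    exact absurd hq (not_lt.2 (ht.trans h1))
  -- The set is empty when `t = 0`, and `sSup ∅ = 0` in `ℕ` is then the intended value.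
  rcases Set.eq_empty_or_nonempty {q : ℕ | envEpoch q e < t} with hs | hs
  · simp [envLast, hs]
  · exact Nat.le_zero.1 (csSup_le hs this)

lemma IsRegular.bddAbove {e : Env N} (h : IsRegular e) (t : ℝ≥0) :
    BddAbove {q : ℕ | envEpoch q e < t} := by
  obtain ⟨q, hq⟩ := (tendsto_atTop.1 h.tendsto t).exists
  exact ⟨q, fun q' hq' => (h.strictMono.lt_iff_lt.1 (lt_of_lt_of_le hq' hq)).le⟩

lemma IsRegular.envEpoch_envLast_le {e : Env N} (h : IsRegular e) (t : ℝ≥0) :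
    envEpoch (envLast e t) e ≤ t := by
  rcases Set.eq_empty_or_nonempty {q : ℕ | envEpoch q e < t} with hs | hs
  · simp [envLast, hs, envEpoch]
  · exact (Nat.sSup_mem hs (h.bddAbove t) : envEpoch (envLast e t) e < t).le

lemma IsRegular.envLast_of_lt {e : Env N} (h : IsRegular e) {t : ℝ≥0} (ht : firstTime e < t) :
    envLast e t = envLast (nextEnv e) (t - firstTime e) + 1 := by
  have hne : {q : ℕ | envEpoch q (nextEnv e) < t - firstTime e}.Nonempty :=
    ⟨0, by simpa [envEpoch] using ht⟩
  have hmem : ∀ q, envEpoch q (nextEnv e) < t - firstTime e ↔ envEpoch (q + 1) e < t := by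
    intro q
    rw [envEpoch, lt_tsub_iff_left]
  refine IsGreatest.csSup_eq ⟨?_, ?_⟩
  · exact (hmem _).1 (Nat.sSup_mem hne (h.next.bddAbove _))
  · intro q hq
    cases q with
    | zero => exact Nat.zero_le _
    | succ q => exact Nat.succ_le_succ (le_csSup (h.next.bddAbove _) ((hmem q).2 hq))

end

/-! ### Transfer of pair functions along the environment -/

/-- Functions of an ordered pair of components. -/
abbrev PairFun (N : ℕ) : Type := Fin N × Fin N → ℂ

/-- Relabel a pair of components by `σ` and damp by `exp (-θ s)` if the pair has not merged. -/
def transfer {N : ℕ} (θ : ℝ) (s : ℝ≥0) (σ : Fin N → Fin N) : PairFun N →ₗ[ℂ] PairFun N where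
  toFun a p := (if σ p.1 = σ p.2 then 1 else ((Real.exp (-(θ * s)) : ℝ) : ℂ)) * a (σ p.1, σ p.2)
  map_add' a b := by funext p; simp [mul_add]
  map_smul' c a := by funext p; simp [mul_left_comm]

lemma transfer_apply {N : ℕ} (θ : ℝ) (s : ℝ≥0) (σ : Fin N → Fin N) (a : PairFun N)
    (p : Fin N × Fin N) : transfer θ s σ a p =
      (if σ p.1 = σ p.2 then 1 else ((Real.exp (-(θ * s)) : ℝ) : ℂ)) * a (σ p.1, σ p.2) := rfl

lemma norm_transfer_le {N : ℕ} {θ : ℝ} (hθ : 0 ≤ θ) (s : ℝ≥0) (σ : Fin N → Fin N) {a : PairFun N}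
    {C : ℝ} (ha : ∀ p, ‖a p‖ ≤ C) (p : Fin N × Fin N) : ‖transfer θ s σ a p‖ ≤ C := by
  rw [transfer_apply, norm_mul]
  refine (mul_le_of_le_one_left (norm_nonneg _) ?_).trans (ha _)
  split_ifs
  · simp
  · rw [Complex.norm_real, Real.norm_of_nonneg (Real.exp_nonneg _), Real.exp_le_one_iff]
    have := mul_nonneg hθ s.coe_nonneg
    linarith

lemma measurable_transfer {N : ℕ} (θ : ℝ) {X : Type*} [MeasurableSpace X] {s : X → ℝ≥0}
    {u : X → Fin N × Fin N} {a : X → PairFun N} (hs : Measurable s) (hu : Measurable u)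
    (ha : Measurable a) : Measurable fun x => transfer θ (s x) (redirect (u x)) (a x) := by
  refine measurable_pi_iff.2 fun p => ?_
  refine measurable_eval_index (f := fun u x => transfer θ (s x) (redirect u) (a x) p)
    (fun v => ?_) hu
  simp only [transfer_apply]
  refine Measurable.mul ?_ ((measurable_pi_apply _).comp ha)
  split_ifs <;> fun_prop

/-- The pair function equal to `1` on the diagonal and to `c` off it. -/
def offDiagFun (N : ℕ) (c : ℂ) : PairFun N := fun p => if p.1 = p.2 then 1 else c

lemma norm_offDiagFun_le {N : ℕ} {c : ℂ} (hc : ‖c‖ ≤ 1) (p : Fin N × Fin N) :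
    ‖offDiagFun N c p‖ ≤ 1 := by
  unfold offDiagFun
  split_ifs
  · simp
  · exact hc

section

variable {N : ℕ} {θ : ℝ}

/-! ### Averaging over the first message -/

/-- A message moves one label onto another, so distinct labels collide only if one of the two
components sends to the other. -/
lemma redirect_eq_iff {p u : Fin N × Fin N} (hp : p.1 ≠ p.2) :
    redirect u p.1 = redirect u p.2 ↔ u = p ∨ u = p.swap := by
  obtain ⟨i, j⟩ := p
  obtain ⟨k, l⟩ := u
  simp only [redirect, Function.update_apply, id_eq, Prod.swap_prod_mk, Prod.mk.injEq]
  simp only at hp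
  split_ifs with h1 h2 h2 <;> grind

lemma redirect_pair_ne {p u : Fin N × Fin N} (h : redirect u p.1 ≠ redirect u p.2) (c : ℂ) :
    offDiagFun N c (redirect u p.1, redirect u p.2) = c := by
  simp [offDiagFun, h]

/-- The probability that a message merges the lineages of two given components. -/
def mergeProb (N : ℕ) : ℝ := 2 / (N * (N - 1))

lemma sum_erase_ite (hN : 2 ≤ N) {p : Fin N × Fin N} (hp : p.1 ≠ p.2) (x y : ℂ) :
    ∑ k : Fin N, ∑ l ∈ Finset.univ.erase k, (if (k, l) = p ∨ (k, l) = p.swap then x else y) =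
      N * (N - 1) * (mergeProb N * x + (1 - mergeProb N) * y) := by
  have h1 : ∀ k l : Fin N, (if (k, l) = p ∨ (k, l) = p.swap then x else y) =
      y + ((if (k, l) = p then x - y else 0) + if (k, l) = p.swap then x - y else 0) := by
    intro k l
    by_cases hk : (k, l) = p
    · have : (k, l) ≠ p.swap := by
        rw [hk]; intro h; exact hp (congrArg Prod.fst h)
      rw [if_pos (.inl hk), if_pos hk, if_neg this]
      ring
    · by_cases hk' : (k, l) = p.swap
      · rw [if_pos (.inr hk'), if_neg hk, if_pos hk']
        ring
      · rw [if_neg (not_or.2 ⟨hk, hk'⟩), if_neg hk, if_neg hk']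
        ring
  have h2 : ∀ p : Fin N × Fin N, p.1 ≠ p.2 →
      ∑ k : Fin N, ∑ l ∈ Finset.univ.erase k, (if (k, l) = p then x - y else 0) = x - y := by
    rintro ⟨i, j⟩ hij
    rw [Finset.sum_eq_single i, Finset.sum_eq_single j]
    · simp
    · intro l _ hl; simp [hl]
    · intro h; exact absurd (Finset.mem_erase.2 ⟨Ne.symm hij, Finset.mem_univ _⟩) h
    · intro k _ hk; simp [hk]
    · simp
  simp only [h1, Finset.sum_add_distrib, h2 p hp, h2 p.swap (Ne.symm hp)]
  have hN1 : (1 : ℕ) ≤ N := by omega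
  simp only [Finset.sum_const, Finset.card_erase_of_mem (Finset.mem_univ _), Finset.card_univ,
    Fintype.card_fin, nsmul_eq_mul, Nat.cast_sub hN1, mergeProb]
  have hn : (N : ℂ) ≠ 0 := by exact_mod_cast (by omega : N ≠ 0)
  have hn1 : (N : ℂ) - 1 ≠ 0 := sub_ne_zero.2 (by exact_mod_cast (by omega : N ≠ 1))
  push_cast
  field_simp
  ring

/-- Of the `N (N - 1)` messages, two merge a given pair, which then contributes `1`; all others
contribute the same damped value. Averaging therefore keeps pair functions constant off the diagonal
and reduces the dynamics to the scalar `c`. -/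
lemma sum_transfer_offDiagFun (hN : 2 ≤ N) (s : ℝ≥0) (c : ℂ) :
    ((N * (N - 1) : ℝ) : ℂ)⁻¹ • ∑ k : Fin N, ∑ l ∈ Finset.univ.erase k,
      transfer θ s (redirect (k, l)) (offDiagFun N c) =
    offDiagFun N (mergeProb N + (1 - mergeProb N) * (Real.exp (-(θ * s)) * c)) := by
  have hn : (N : ℂ) ≠ 0 := by exact_mod_cast (by omega : N ≠ 0)
  have hn1 : (N : ℂ) - 1 ≠ 0 := sub_ne_zero.2 (by exact_mod_cast (by omega : N ≠ 1))
  have hN1 : (1 : ℕ) ≤ N := by omega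
  funext p
  simp only [Pi.smul_apply, Finset.sum_apply, smul_eq_mul]
  by_cases hp : p.1 = p.2
  · have : ∀ k l, transfer θ s (redirect (k, l)) (offDiagFun N c) p = 1 := by
      intro k l
      simp [transfer_apply, hp, offDiagFun]
    simp only [this, Finset.sum_const, Finset.card_erase_of_mem (Finset.mem_univ _),
      Finset.card_univ, Fintype.card_fin, nsmul_eq_mul, Nat.cast_sub hN1, offDiagFun, hp, if_true]
    push_cast
    field_simp
  · have : ∀ k l, transfer θ s (redirect (k, l)) (offDiagFun N c) p =
        if (k, l) = p ∨ (k, l) = p.swap then 1 else Real.exp (-(θ * s)) * c := by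
      intro k l
      rw [transfer_apply]
      by_cases hr : redirect (k, l) p.1 = redirect (k, l) p.2
      · rw [if_pos hr, if_pos ((redirect_eq_iff hp).1 hr)]
        simp [offDiagFun, hr]
      · rw [if_neg hr, if_neg (mt (redirect_eq_iff hp).2 hr), redirect_pair_ne hr]
    simp only [this]
    rw [sum_erase_ite hN hp]
    simp only [offDiagFun, hp, if_false]
    push_cast
    field_simp

lemma integral_pairLaw (hN : 2 ≤ N) (g : Fin N × Fin N → ℂ) :
    ∫ u, g u ∂pairLaw N = ((N * (N - 1) : ℝ) : ℂ)⁻¹ *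
      ∑ k : Fin N, ∑ l ∈ Finset.univ.erase k, g (k, l) := by
  have := isProbabilityMeasure_unifNe hN
  have hne : ∀ k : Fin N, ∫ u, g (k, u) ∂unifNe k =
      ((N : ℂ) - 1)⁻¹ * ∑ l ∈ Finset.univ.erase k, g (k, l) := by
    intro k
    rw [unifNe, integral_smul_measure, integral_finsetSum_measure fun _ _ => by simp]
    simp only [integral_dirac, ENNReal.toReal_inv]
    rw [ENNReal.toReal_sub_of_le (by exact_mod_cast (by omega : 1 ≤ N)) (by simp)]
    rw [Complex.real_smul]
    simp
  rw [pairLaw, integral_smul_measure, integral_finsetSum_measure fun k _ => .of_finite]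
  have hmap : ∀ k : Fin N, ∫ u, g u ∂(unifNe k).map (Prod.mk k) = ∫ u, g (k, u) ∂unifNe k :=
    fun k => integral_map (by fun_prop) (by fun_prop)
  simp only [hmap, hne, ← Finset.mul_sum, Complex.real_smul]
  simp [mul_assoc, mul_left_comm]

end

/-! ### The flow of pair functions along a random environment. -/

section

variable {N : ℕ} [NeZero N] {r θ : ℝ}

/-- The transfer of pair functions through the first `q` epochs. -/
def envTransfer (θ : ℝ) : ℕ → Env N → PairFun N →ₗ[ℂ] PairFun N
  | 0, _ => LinearMap.id
  | q + 1, e => (transfer θ (firstTime (nextEnv^[q] e)) (redirect (firstPair (nextEnv^[q] e)))).comp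
      (envTransfer θ q e)

/-- The definition adds the latest message on the outside, whereas conditioning on the first message
needs the earliest one, which acts directly on the initial pair function. -/
lemma envTransfer_succ_front (q : ℕ) (e : Env N) (a : PairFun N) :
    envTransfer θ (q + 1) e a =
      envTransfer θ q (nextEnv e) (transfer θ (firstTime e) (redirect (firstPair e)) a) := by
  induction q with
  | zero => rfl
  | succ q ih =>
    rw [envTransfer, LinearMap.comp_apply, ih, envTransfer, LinearMap.comp_apply,
      Function.iterate_succ_apply]

/-- The transfer of pair functions up to time `t`. -/
def envFlow (θ : ℝ) (e : Env N) (t : ℝ≥0) : PairFun N →ₗ[ℂ] PairFun N :=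
  (transfer θ (t - envEpoch (envLast e t) e) id).comp (envTransfer θ (envLast e t) e)

lemma IsRegular.envFlow_of_le {e : Env N} (h : IsRegular e) {t : ℝ≥0} (ht : t ≤ firstTime e)
    (a : PairFun N) : envFlow θ e t a = transfer θ t id a := by
  simp [envFlow, h.envLast_of_le ht, envEpoch, envTransfer]

lemma IsRegular.envFlow_of_lt {e : Env N} (h : IsRegular e) {t : ℝ≥0} (ht : firstTime e < t)
    (a : PairFun N) : envFlow θ e t a =
      envFlow θ (nextEnv e) (t - firstTime e)
        (transfer θ (firstTime e) (redirect (firstPair e)) a) := by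
  rw [envFlow, h.envLast_of_lt ht, LinearMap.comp_apply, envTransfer_succ_front, envFlow,
    LinearMap.comp_apply, envEpoch, tsub_add_eq_tsub_tsub]

lemma norm_envTransfer_le (hθ : 0 ≤ θ) (q : ℕ) (e : Env N) {a : PairFun N} {C : ℝ}
    (ha : ∀ p, ‖a p‖ ≤ C) (p : Fin N × Fin N) : ‖envTransfer θ q e a p‖ ≤ C := by
  induction q generalizing p with
  | zero => exact ha p
  | succ q ih => exact norm_transfer_le hθ _ _ ih p

lemma norm_envFlow_le (hθ : 0 ≤ θ) (e : Env N) (t : ℝ≥0) {a : PairFun N} {C : ℝ}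
    (ha : ∀ p, ‖a p‖ ≤ C) (p : Fin N × Fin N) : ‖envFlow θ e t a p‖ ≤ C :=
  norm_transfer_le hθ _ _ (norm_envTransfer_le hθ _ e ha) p

lemma measurable_envTransfer (θ : ℝ) (q : ℕ) :
    Measurable fun x : Env N × PairFun N => envTransfer θ q x.1 x.2 := by
  induction q with
  | zero => exact measurable_snd
  | succ q ih =>
    have := measurable_nextEnv (N := N).iterate q
    exact measurable_transfer θ (measurable_firstTime.comp (this.comp measurable_fst))
      (measurable_firstPair.comp (this.comp measurable_fst)) ih

lemma measurable_envLast : Measurable fun x : Env N × ℝ≥0 => envLast x.1 x.2 := by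
  have hsup : ∀ x : Env N × ℝ≥0, envLast x.1 x.2 =
      ⨆ q : ℕ, if envEpoch q x.1 < x.2 then q else 0 := by
    intro x
    set S := {q : ℕ | envEpoch q x.1 < x.2} with hS
    have hrange : (Set.range fun q : ℕ => if envEpoch q x.1 < x.2 then q else 0) ⊆ insert 0 S := by
      rintro _ ⟨q, rfl⟩
      by_cases hq : envEpoch q x.1 < x.2
      · simp [hq, hS]
      · simp [hq]
    have hsub : S ⊆ Set.range fun q : ℕ => if envEpoch q x.1 < x.2 then q else 0 :=
      fun q hq => ⟨q, if_pos hq⟩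
    rw [iSup, envLast]
    by_cases hb : BddAbove S
    · have hb' := (hb.insert 0).mono hrange
      refine le_antisymm ?_ ?_
      · rcases S.eq_empty_or_nonempty with he | he
        · simp [← hS, he]
        · exact csSup_le_csSup hb' he hsub
      · refine csSup_le (Set.range_nonempty _) fun q hq => ?_
        rcases hrange hq with rfl | hq
        · exact Nat.zero_le _
        · exact le_csSup hb hq
    -- In the unbounded case both suprema in `ℕ` take the default value `0`, so the identity holds
    -- without regularity.
    · rw [Nat.sSup_of_not_bddAbove hb, Nat.sSup_of_not_bddAbove fun h => hb (h.mono hsub)]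
  simp only [hsup]
  refine Measurable.iSup fun q => ?_
  exact Measurable.ite (measurableSet_lt ((measurable_envEpoch q).comp measurable_fst)
    measurable_snd) measurable_const measurable_const

lemma measurable_envFlow (θ : ℝ) :
    Measurable fun x : (Env N × ℝ≥0) × PairFun N => envFlow θ x.1.1 x.1.2 x.2 := by
  refine measurable_pi_iff.2 fun p => ?_
  simp only [envFlow, LinearMap.comp_apply]
  refine measurable_eval_index
    (f := fun q (x : (Env N × ℝ≥0) × PairFun N) =>
      transfer θ (x.1.2 - envEpoch q x.1.1) id (envTransfer θ q x.1.1 x.2) p)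
    (fun q => ?_)
    ((measurable_envLast (N := N)).comp (measurable_fst (β := PairFun N)))
  have h1 := (measurable_envEpoch (N := N) q).comp
    (measurable_fst.comp measurable_fst : Measurable fun x : (Env N × ℝ≥0) × PairFun N => x.1.1)
  have h2 : Measurable fun x : (Env N × ℝ≥0) × PairFun N => envTransfer θ q x.1.1 x.2 :=
    (measurable_envTransfer θ q).comp
      (f := fun x : (Env N × ℝ≥0) × PairFun N => (x.1.1, x.2)) (by fun_prop)
  have h3 : Measurable fun x : (Env N × ℝ≥0) × PairFun N => x.1.2 - envEpoch q x.1.1 :=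
    (measurable_snd.comp measurable_fst).sub h1
  simp only [transfer_apply, id_eq]
  refine Measurable.mul ?_ ((measurable_pi_apply _).comp h2)
  split_ifs <;> fun_prop

end

/-! ### The renewal equation -/

lemma integral_expNN {r : ℝ} (hr : 0 < r) {f : ℝ≥0 → ℂ} (hf : Measurable f) :
    ∫ s, f s ∂expNN r =
      ∫ x in Set.Ici (0 : ℝ), ((r * Real.exp (-(r * x)) : ℝ) : ℂ) * f x.toNNReal := by
  have hpdf : Measurable (exponentialPDF r) :=
    (measurable_exponentialPDFReal r).ennreal_ofReal
  have : expMeasure r = volume.withDensity (exponentialPDF r) := rfl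
  rw [expNN, integral_map (by fun_prop) hf.aestronglyMeasurable, this,
    integral_withDensity_eq_integral_toReal_smul hpdf (by simp [exponentialPDF]),
    ← integral_indicator measurableSet_Ici]
  refine integral_congr_ae (.of_forall fun x => ?_)
  by_cases hx : 0 ≤ x
  · simp only [Set.mem_Ici, hx, Set.indicator_of_mem, exponentialPDF_of_nonneg hx]
    rw [ENNReal.toReal_ofReal (by positivity), Complex.real_smul]
  · simp [hx, exponentialPDF_of_neg (not_le.1 hx)]

/-- The characteristic function at time `t` of the difference of two components, started from
the value `c`, when lineages merge at rate `κ`. -/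
def mergeCurve (κ θ : ℝ) (c : ℂ) (t : ℝ) : ℂ :=
  (κ / (κ + θ) : ℝ) + (c - (κ / (κ + θ) : ℝ)) * (Real.exp (-((κ + θ) * t)) : ℝ)

lemma norm_mergeCurve_le {κ θ : ℝ} (hκ : 0 < κ) (hθ : 0 ≤ θ) {c : ℂ} (hc : ‖c‖ ≤ 1) {t : ℝ}
    (ht : 0 ≤ t) : ‖mergeCurve κ θ c t‖ ≤ 1 := by
  have hE : Real.exp (-((κ + θ) * t)) ≤ 1 := by
    rw [Real.exp_le_one_iff]
    have : 0 ≤ (κ + θ) * t := by positivity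
    linarith
  have hy0 : 0 ≤ κ / (κ + θ) := by positivity
  have hy : κ / (κ + θ) ≤ 1 := by rw [div_le_one (by positivity)]; linarith
  set y := κ / (κ + θ)
  set E := Real.exp (-((κ + θ) * t)) with hEdef
  have hE0 : 0 ≤ E := Real.exp_nonneg _
  have : mergeCurve κ θ c t = ((y * (1 - E) : ℝ) : ℂ) + c * (E : ℝ) := by
    change (y : ℂ) + (c - y) * (E : ℂ) = _
    push_cast
    ring
  rw [this]
  refine (norm_add_le _ _).trans ?_
  rw [norm_mul, Complex.norm_real, Complex.norm_real, Real.norm_of_nonneg hE0,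
    Real.norm_of_nonneg (mul_nonneg hy0 (by linarith))]
  nlinarith [norm_nonneg c]

lemma continuous_mergeCurve_uncurry (κ θ : ℝ) :
    Continuous fun x : ℂ × ℝ => mergeCurve κ θ x.1 x.2 := by
  unfold mergeCurve
  fun_prop

lemma hasDerivAt_ofReal_exp_affine (a b x : ℝ) :
    HasDerivAt (fun x : ℝ => ((Real.exp (a * x + b) : ℝ) : ℂ))
      ((a : ℂ) * (Real.exp (a * x + b) : ℝ)) x := by
  have h1 : HasDerivAt (fun x : ℝ => a * x + b) a x := by
    simpa using ((hasDerivAt_id x).const_mul a).add_const b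
  have h2 := h1.exp.ofReal_comp
  convert! h2 using 1
  push_cast
  ring

/-- The merge curve solves the renewal equation. -/
lemma integral_mergeCurve {κ θ ν : ℝ} (hκ : 0 < κ) (hθ : 0 ≤ θ) (hν : 0 < ν) (c : ℂ) (t : ℝ) :
    ∫ x in (0 : ℝ)..t, ((ν * Real.exp (-(ν * x)) : ℝ) : ℂ) *
        mergeCurve κ θ ((κ / ν : ℝ) + (1 - (κ / ν : ℝ)) * ((Real.exp (-(θ * x)) : ℝ) * c)) (t - x) =
      mergeCurve κ θ c t - (Real.exp (-(ν * t)) : ℝ) * ((Real.exp (-(θ * t)) : ℝ) * c) := by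
  have hsum : κ + θ ≠ 0 := by positivity
  set y : ℝ := κ / (κ + θ) with hy
  set w : ℝ := κ + θ with hw
  -- An antiderivative of the integrand: it is `-exp (-ν x)` times `mergeCurve κ θ (exp (-θ x) c) (t
  -- - x)`, expanded into exponentials. Its endpoint values are the two terms on the right.
  let F : ℝ → ℂ := fun x => -((y : ℂ) * (Real.exp (-ν * x + 0) : ℝ) +
    c * (Real.exp ((κ - ν) * x + -(w * t)) : ℝ) -
    (y : ℂ) * (Real.exp ((w - ν) * x + -(w * t)) : ℝ))
  have hF : ∀ x, HasDerivAt F (((ν * Real.exp (-(ν * x)) : ℝ) : ℂ) *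
      mergeCurve κ θ ((κ / ν : ℝ) + (1 - (κ / ν : ℝ)) * ((Real.exp (-(θ * x)) : ℝ) * c))
        (t - x)) x := by
    intro x
    have h1 := (((hasDerivAt_ofReal_exp_affine (-ν) 0 x).const_mul (y : ℂ)).add
      ((hasDerivAt_ofReal_exp_affine (κ - ν) (-(w * t)) x).const_mul c)).sub
      ((hasDerivAt_ofReal_exp_affine (w - ν) (-(w * t)) x).const_mul (y : ℂ))
    refine h1.neg.congr_deriv ?_
    have e1 : Real.exp (-ν * x + 0) = Real.exp (-(ν * x)) := by ring_nf
    have e2 : Real.exp ((κ - ν) * x + -(w * t)) =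
        Real.exp (-(ν * x)) * (Real.exp (-(θ * x)) * Real.exp (-(w * (t - x)))) := by
      rw [← Real.exp_add, ← Real.exp_add, hw]; ring_nf
    have e3 : Real.exp ((w - ν) * x + -(w * t)) =
        Real.exp (-(ν * x)) * Real.exp (-(w * (t - x))) := by
      rw [← Real.exp_add]; ring_nf
    have hyw : (y : ℂ) * w = κ := by
      rw [← Complex.ofReal_mul, hy, div_mul_cancel₀ _ hsum]
    have hν' : (ν : ℂ) ≠ 0 := by exact_mod_cast hν.ne'
    rw [e1, e2, e3]
    simp only [mergeCurve, ← hw, ← hy]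
    generalize Real.exp (-(ν * x)) = A
    generalize Real.exp (-(θ * x)) = B
    generalize Real.exp (-(w * (t - x))) = E
    push_cast
    field_simp
    linear_combination (A : ℂ) * E * hyw
  rw [intervalIntegral.integral_eq_sub_of_hasDerivAt (fun x _ => hF x)]
  · have e1 : Real.exp ((κ - ν) * t + -(w * t)) =
        Real.exp (-(ν * t)) * Real.exp (-(θ * t)) := by
      rw [← Real.exp_add, hw]; ring_nf
    have e2 : Real.exp ((w - ν) * t + -(w * t)) = Real.exp (-(ν * t)) := by ring_nf
    have e3 : Real.exp (-ν * t) = Real.exp (-(ν * t)) := by ring_nf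
    simp only [F, e1, e2, e3, mul_zero, zero_add, add_zero, Real.exp_zero, mergeCurve, ← hw, ← hy]
    push_cast
    ring
  · refine Continuous.intervalIntegrable ?_ _ _
    refine Continuous.mul (by fun_prop) ?_
    exact (continuous_mergeCurve_uncurry κ θ).comp (by fun_prop : Continuous fun x : ℝ =>
      ((((κ / ν : ℝ) + (1 - (κ / ν : ℝ)) * ((Real.exp (-(θ * x)) : ℝ) * c)) : ℂ), t - x))

/-- The renewal equation in the form met by conditioning: no message before `t` has probability `exp
(-ν t)` and supplies exactly the term subtracted in `integral_mergeCurve`. -/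
lemma integral_expNN_ite_mergeCurve {κ θ ν : ℝ} (hκ : 0 < κ) (hθ : 0 ≤ θ) (hν : 0 < ν) (c : ℂ)
    (t : ℝ≥0) :
    ∫ s, (if t ≤ s then ((Real.exp (-(θ * t)) : ℝ) : ℂ) * c else
        mergeCurve κ θ ((κ / ν : ℝ) + (1 - (κ / ν : ℝ)) * ((Real.exp (-(θ * s)) : ℝ) * c))
          ((t - s : ℝ≥0) : ℝ)) ∂expNN ν = mergeCurve κ θ c t := by
  have := isProbabilityMeasure_expNN hν
  have hG : Measurable fun s : ℝ≥0 => mergeCurve κ θ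
      ((κ / ν : ℝ) + (1 - (κ / ν : ℝ)) * ((Real.exp (-(θ * s)) : ℝ) * c))
        ((t - s : ℝ≥0) : ℝ) :=
    ((continuous_mergeCurve_uncurry κ θ).measurable).comp
      (f := fun s : ℝ≥0 => ((((κ / ν : ℝ) +
        (1 - (κ / ν : ℝ)) * ((Real.exp (-(θ * s)) : ℝ) * c)) : ℂ), ((t - s : ℝ≥0) : ℝ)))
      (by fun_prop)
  have hle : MeasurableSet {s : ℝ≥0 | t ≤ s} := measurableSet_Ici
  have h0 : 0 ≤ (t : ℝ) := t.coe_nonneg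
  have hm : Measurable fun s : ℝ≥0 => if t ≤ s then ((Real.exp (-(θ * t)) : ℝ) : ℂ) * c else
      mergeCurve κ θ ((κ / ν : ℝ) + (1 - (κ / ν : ℝ)) * ((Real.exp (-(θ * s)) : ℝ) * c))
        ((t - s : ℝ≥0) : ℝ) := Measurable.ite hle measurable_const hG
  rw [integral_expNN hν hm]
  have hsplit : Set.Ici (0 : ℝ) = Set.Ico 0 (t : ℝ) ∪ Set.Ici (t : ℝ) :=
    (Set.Ico_union_Ici_eq_Ici h0).symm
  have hexp : ∫ x in Set.Ici (t : ℝ), (ν * Real.exp (-(ν * x))) = Real.exp (-(ν * t)) := by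
    have := integral_exp_mul_Ioi (neg_neg_iff_pos.2 hν) t
    rw [integral_Ici_eq_integral_Ioi, integral_const_mul]
    simp only [neg_mul] at this
    rw [this]
    field_simp
  have hexpC : ∫ x in Set.Ici (t : ℝ), ((ν * Real.exp (-(ν * x)) : ℝ) : ℂ) =
      (Real.exp (-(ν * t)) : ℝ) := integral_ofReal.trans (congrArg _ hexp)
  have hint : IntegrableOn (fun x : ℝ => ((ν * Real.exp (-(ν * x)) : ℝ) : ℂ)) (Set.Ici (t : ℝ)) := by
    have h1 : IntegrableOn (fun x : ℝ => ν * Real.exp (-(ν * x))) (Set.Ici (t : ℝ)) := by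
      rw [integrableOn_Ici_iff_integrableOn_Ioi]
      have := (exp_neg_integrableOn_Ioi (t : ℝ) hν).const_mul ν
      simp only [neg_mul] at this
      exact this
    exact Integrable.ofReal h1
  have hcongr1 : Set.EqOn (fun x : ℝ => ((ν * Real.exp (-(ν * x)) : ℝ) : ℂ) *
      (if t ≤ x.toNNReal then ((Real.exp (-(θ * t)) : ℝ) : ℂ) * c else
        mergeCurve κ θ ((κ / ν : ℝ) + (1 - (κ / ν : ℝ)) *
          ((Real.exp (-(θ * (x.toNNReal : ℝ))) : ℝ) * c)) ((t - x.toNNReal : ℝ≥0) : ℝ)))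
      (fun x => ((ν * Real.exp (-(ν * x)) : ℝ) : ℂ) *
        mergeCurve κ θ ((κ / ν : ℝ) + (1 - (κ / ν : ℝ)) * ((Real.exp (-(θ * x)) : ℝ) * c))
          (t - x)) (Set.Ico 0 (t : ℝ)) := by
    intro x hx
    have hx1 : x.toNNReal < t := Real.toNNReal_lt_iff_lt_coe hx.1 |>.2 hx.2
    simp only [if_neg (not_le.2 hx1), NNReal.coe_sub hx1.le, Real.coe_toNNReal _ hx.1]
  have hcongr2 : Set.EqOn (fun x : ℝ => ((ν * Real.exp (-(ν * x)) : ℝ) : ℂ) *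
      (if t ≤ x.toNNReal then ((Real.exp (-(θ * t)) : ℝ) : ℂ) * c else
        mergeCurve κ θ ((κ / ν : ℝ) + (1 - (κ / ν : ℝ)) *
          ((Real.exp (-(θ * (x.toNNReal : ℝ))) : ℝ) * c)) ((t - x.toNNReal : ℝ≥0) : ℝ)))
      (fun x => ((ν * Real.exp (-(ν * x)) : ℝ) : ℂ) * (((Real.exp (-(θ * t)) : ℝ) : ℂ) * c))
      (Set.Ici (t : ℝ)) := by
    intro x hx
    have hx1 : t ≤ x.toNNReal := NNReal.le_toNNReal_of_coe_le hx
    simp only [if_pos hx1]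
  have hcont : Continuous fun x : ℝ => ((ν * Real.exp (-(ν * x)) : ℝ) : ℂ) *
        mergeCurve κ θ ((κ / ν : ℝ) + (1 - (κ / ν : ℝ)) * ((Real.exp (-(θ * x)) : ℝ) * c))
          (t - x) :=
    Continuous.mul (by fun_prop) ((continuous_mergeCurve_uncurry κ θ).comp (by fun_prop :
      Continuous fun x : ℝ =>
      ((((κ / ν : ℝ) + (1 - (κ / ν : ℝ)) * ((Real.exp (-(θ * x)) : ℝ) * c)) : ℂ), t - x)))
  have hdisj : Disjoint (Set.Ico 0 (t : ℝ)) (Set.Ici (t : ℝ)) :=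
    Set.disjoint_left.2 fun x hx hx' => not_lt.2 hx' hx.2
  rw [hsplit, setIntegral_union hdisj measurableSet_Ici]
  · rw [setIntegral_congr_fun measurableSet_Ico hcongr1,
      setIntegral_congr_fun measurableSet_Ici hcongr2, integral_mul_const, hexpC,
      integral_Ico_eq_integral_Ioc, ← intervalIntegral.integral_of_le h0,
      integral_mergeCurve hκ hθ hν]
    ring
  · refine IntegrableOn.congr_fun ?_ hcongr1.symm measurableSet_Ico
    exact (hcont.integrableOn_Icc).mono_set Set.Ico_subset_Icc_self
  · exact IntegrableOn.congr_fun (hint.mul_const _) hcongr2.symm measurableSet_Ici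

lemma norm_merge_le {N : ℕ} {θ : ℝ} (hN : 2 ≤ N) (hθ : 0 ≤ θ) (s : ℝ≥0) {c : ℂ} (hc : ‖c‖ ≤ 1) :
    ‖(mergeProb N + (1 - mergeProb N) * (Real.exp (-(θ * s)) * c) : ℂ)‖ ≤ 1 := by
  have hN' : (2 : ℝ) ≤ N := by exact_mod_cast hN
  have h0 : 0 ≤ mergeProb N := div_nonneg zero_le_two (by nlinarith)
  have h1 : mergeProb N ≤ 1 := by
    rw [mergeProb, div_le_one (by nlinarith)]; nlinarith
  have hE : Real.exp (-(θ * s)) ≤ 1 := by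
    rw [Real.exp_le_one_iff]
    have := mul_nonneg hθ s.coe_nonneg
    linarith
  refine (norm_add_le _ _).trans ?_
  have h2 : ‖(Real.exp (-(θ * s)) * c : ℂ)‖ ≤ 1 := by
    rw [norm_mul, Complex.norm_real, Real.norm_of_nonneg (Real.exp_nonneg _)]
    exact mul_le_one₀ hE (norm_nonneg _) hc
  rw [norm_mul, ← Complex.ofReal_one, ← Complex.ofReal_sub, Complex.norm_real, Complex.norm_real,
    Real.norm_of_nonneg h0, Real.norm_of_nonneg (sub_nonneg.2 h1)]
  nlinarith

/-! ### The mean flow and its identification with the merge curve. -/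

section

variable {N : ℕ} [NeZero N] {r θ : ℝ}

/-- The mean flow of a pair function which is constant off the diagonal. -/
def meanFlow (N : ℕ) [NeZero N] (r θ : ℝ) (c : ℂ) (p : Fin N × Fin N) (t : ℝ≥0) : ℂ :=
  ∫ e, envFlow θ e t (offDiagFun N c) p ∂envLaw N r

lemma measurable_envFlow_apply (θ : ℝ) {X : Type*} [MeasurableSpace X] {e : X → Env N}
    {t : X → ℝ≥0} {a : X → PairFun N} (he : Measurable e) (ht : Measurable t)
    (ha : Measurable a) (p : Fin N × Fin N) :
    Measurable fun x => envFlow θ (e x) (t x) (a x) p := by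
  have h := (measurable_envFlow (N := N) θ).comp ((he.prodMk ht).prodMk ha)
  exact measurable_pi_iff.1 h p

lemma norm_meanFlow_le (hN : 2 ≤ N) (hr : 0 < r) (hθ : 0 ≤ θ) {c : ℂ} (hc : ‖c‖ ≤ 1)
    (p : Fin N × Fin N) (t : ℝ≥0) : ‖meanFlow N r θ c p t‖ ≤ 1 := by
  have := isProbabilityMeasure_envLaw hN hr
  refine (norm_integral_le_of_norm_le_const (.of_forall fun e =>
    norm_envFlow_le hθ e t (norm_offDiagFun_le hc) p)).trans ?_
  simp

/-- Conditioning on the first message. -/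
lemma meanFlow_renewal (hN : 2 ≤ N) (hr : 0 < r) (hθ : 0 ≤ θ) {c : ℂ} (hc : ‖c‖ ≤ 1)
    {p : Fin N × Fin N} (hp : p.1 ≠ p.2) (t : ℝ≥0) :
    Integrable (fun s => if t ≤ s then ((Real.exp (-(θ * t)) : ℝ) : ℂ) * c else
      meanFlow N r θ (mergeProb N + (1 - mergeProb N) * (Real.exp (-(θ * s)) * c)) p (t - s))
      (expNN (N * r)) ∧
    meanFlow N r θ c p t = ∫ s, (if t ≤ s then ((Real.exp (-(θ * t)) : ℝ) : ℂ) * c else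
      meanFlow N r θ (mergeProb N + (1 - mergeProb N) * (Real.exp (-(θ * s)) * c)) p (t - s))
      ∂expNN (N * r) := by
  have := isProbabilityMeasure_envLaw hN hr
  have := isProbabilityMeasure_pairLaw hN
  have hN0 : (0 : ℝ) < N := by exact_mod_cast (by omega : 0 < N)
  have := isProbabilityMeasure_expNN (mul_pos hN0 hr)
  have hnorm := norm_offDiagFun_le (N := N) hc
  let G : ℝ≥0 × (Fin N × Fin N) × Env N → ℂ := fun x =>
    if t ≤ x.1 then transfer θ t id (offDiagFun N c) p else
      envFlow θ x.2.2 (t - x.1) (transfer θ x.1 (redirect x.2.1) (offDiagFun N c)) p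
  have hG : Measurable G := by
    refine Measurable.ite (measurableSet_le measurable_const measurable_fst) measurable_const ?_
    exact measurable_envFlow_apply θ (by fun_prop) (by fun_prop)
      (measurable_transfer θ (by fun_prop) (by fun_prop) measurable_const) p
  have hGb : ∀ x, ‖G x‖ ≤ 1 := by
    intro x
    simp only [G]
    split_ifs
    · exact norm_transfer_le hθ _ _ hnorm p
    · exact norm_envFlow_le hθ _ _ (norm_transfer_le hθ _ _ hnorm) p
  have hGi : Integrable G ((expNN (N * r)).prod ((pairLaw N).prod (envLaw N r))) :=
    .of_bound hG.aestronglyMeasurable 1 (.of_forall hGb)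
  have h1 : meanFlow N r θ c p t = ∫ e, G (step e) ∂envLaw N r := by
    refine integral_congr_ae ?_
    filter_upwards [ae_isRegular hN hr] with e he
    by_cases ht : t ≤ firstTime e
    · rw [he.envFlow_of_le ht]
      exact (if_pos ht).symm
    · rw [he.envFlow_of_lt (not_le.1 ht)]
      exact (if_neg ht).symm
  have h2 : ∀ s, ∫ y, G (s, y) ∂(pairLaw N).prod (envLaw N r) =
      if t ≤ s then ((Real.exp (-(θ * t)) : ℝ) : ℂ) * c else
      meanFlow N r θ (mergeProb N + (1 - mergeProb N) * (Real.exp (-(θ * s)) * c)) p (t - s) := by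
    intro s
    by_cases ht : t ≤ s
    · simp [G, ht, transfer_apply, hp, offDiagFun]
    · have hi : Integrable (fun y => G (s, y)) ((pairLaw N).prod (envLaw N r)) :=
        .of_bound (hG.comp measurable_prodMk_left).aestronglyMeasurable 1
          (.of_forall fun y => hGb _)
      have hGk : ∀ u : Fin N × Fin N, Integrable (fun e => G (s, u, e)) (envLaw N r) := fun u =>
        .of_bound (hG.comp (by fun_prop)).aestronglyMeasurable 1 (.of_forall fun y => hGb _)
      -- Since `envFlow` is linear in the pair function, the average over the first pair can be
      -- taken inside it, where `sum_transfer_offDiagFun` applies.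
      rw [if_neg ht, integral_prod _ hi, integral_pairLaw hN]
      simp only [← integral_finsetSum _ fun l (_ : l ∈ Finset.univ.erase _) => hGk (_, l)]
      rw [← integral_finsetSum _ fun k _ => integrable_finsetSum _ fun l _ => hGk (k, l),
        ← integral_const_mul, meanFlow, ← sum_transfer_offDiagFun hN]
      refine integral_congr_ae (.of_forall fun e => ?_)
      simp only [G, if_neg ht, map_smul, map_sum, Pi.smul_apply, Finset.sum_apply, smul_eq_mul]
  have h3 : meanFlow N r θ c p t =
      ∫ s, ∫ y, G (s, y) ∂(pairLaw N).prod (envLaw N r) ∂expNN (N * r) := by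
    rw [h1, ← integral_map measurable_step.aemeasurable hG.aestronglyMeasurable, map_step hN hr,
      integral_prod _ hGi]
  have h4 := hGi.integral_prod_left
  simp only [h2] at h3 h4
  exact ⟨h4, h3⟩

/-- The mean flow is the merge curve. -/
lemma meanFlow_eq (hN : 2 ≤ N) (hr : 0 < r) (hθ : 0 ≤ θ) {c : ℂ} (hc : ‖c‖ ≤ 1)
    {p : Fin N × Fin N} (hp : p.1 ≠ p.2) (t : ℝ≥0) :
    meanFlow N r θ c p t = mergeCurve (mergeProb N * (N * r)) θ c t := by
  have hN' : (2 : ℝ) ≤ N := by exact_mod_cast hN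
  have hν : 0 < N * r := by positivity
  have hp0 : 0 < mergeProb N := div_pos zero_lt_two (by nlinarith)
  set κ := mergeProb N * (N * r) with hκdef
  have hκ : 0 < κ := mul_pos hp0 hν
  have hκν : κ / (N * r) = mergeProb N := by rw [hκdef]; field_simp
  have := isProbabilityMeasure_expNN hν
  -- Here `ρ` is a contraction factor: the probability of a message before time `t`.
  set ρ := 1 - Real.exp (-((N * r) * t)) with hρ
  have hρ0 : 0 ≤ ρ := by
    rw [hρ, sub_nonneg, Real.exp_le_one_iff]
    have := mul_nonneg hν.le t.coe_nonneg
    linarith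
  have hρ1 : ρ < 1 := by
    rw [hρ]
    linarith [Real.exp_pos (-((N * r) * t))]
  -- Both functions are bounded by `1` and solve the same renewal equation. They can differ only if
  -- a message occurs before `s`, so each use of the equation gains a factor `ρ`. The bound must be
  -- uniform over the unit disc and over `s ≤ t`, because a message changes both `c` and the
  -- remaining time.
  have key : ∀ n : ℕ, ∀ s ≤ t, ∀ c : ℂ, ‖c‖ ≤ 1 →
      ‖meanFlow N r θ c p s - mergeCurve κ θ c s‖ ≤ 2 * ρ ^ n := by
    intro n
    induction n with
    | zero =>
      intro s _ c hc
      have h1 := norm_meanFlow_le hN hr hθ hc p s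
      have h2 := norm_mergeCurve_le hκ hθ hc s.coe_nonneg
      have := norm_sub_le (meanFlow N r θ c p s) (mergeCurve κ θ c s)
      rw [pow_zero]
      linarith
    | succ n ih =>
      intro s hs c hc
      obtain ⟨hint, heq⟩ := meanFlow_renewal hN hr hθ hc hp s
      have hy := integral_expNN_ite_mergeCurve hκ hθ hν c s
      rw [hκν] at hy
      have hym : Measurable fun u : ℝ≥0 => mergeCurve κ θ
          (mergeProb N + (1 - mergeProb N) * ((Real.exp (-(θ * u)) : ℝ) * c))
          ((s - u : ℝ≥0) : ℝ) :=
        ((continuous_mergeCurve_uncurry κ θ).measurable).comp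
          (f := fun u : ℝ≥0 => (((mergeProb N +
            (1 - mergeProb N) * ((Real.exp (-(θ * u)) : ℝ) * c)) : ℂ), ((s - u : ℝ≥0) : ℝ)))
          (by fun_prop)
      have hyi : Integrable (fun u => if s ≤ u then ((Real.exp (-(θ * s)) : ℝ) : ℂ) * c else
          mergeCurve κ θ (mergeProb N + (1 - mergeProb N) * ((Real.exp (-(θ * u)) : ℝ) * c))
          ((s - u : ℝ≥0) : ℝ)) (expNN (N * r)) := by
        refine .of_bound (Measurable.ite measurableSet_Ici measurable_const
          hym).aestronglyMeasurable 1 (.of_forall fun u => ?_)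
        split_ifs
        · rw [norm_mul, Complex.norm_real, Real.norm_of_nonneg (Real.exp_nonneg _)]
          refine mul_le_one₀ ?_ (norm_nonneg _) hc
          rw [Real.exp_le_one_iff]
          have := mul_nonneg hθ s.coe_nonneg
          linarith
        · exact norm_mergeCurve_le hκ hθ (norm_merge_le hN hθ u hc) (NNReal.coe_nonneg _)
      rw [heq, ← hy]
      push_cast at hint hyi ⊢
      rw [← integral_sub hint hyi]
      have hbound : ∀ u : ℝ≥0, ‖(if s ≤ u then (Complex.exp (-(θ * s)) * c) else
          meanFlow N r θ (mergeProb N + (1 - mergeProb N) * (Complex.exp (-(θ * u)) * c)) p (s - u)) -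
          (if s ≤ u then (Complex.exp (-(θ * s)) * c) else
          mergeCurve κ θ (mergeProb N + (1 - mergeProb N) * (Complex.exp (-(θ * u)) * c))
          ((s - u : ℝ≥0) : ℝ))‖ ≤ (Set.Ici s)ᶜ.indicator (fun _ => 2 * ρ ^ n) u := by
        intro u
        by_cases hu : s ≤ u
        · simp [hu]
        · have h1 := norm_merge_le hN hθ u hc
          push_cast at h1
          have := ih (s - u) (tsub_le_self.trans hs) _ h1
          simpa [hu, not_le.1 hu] using this
      refine (norm_integral_le_of_norm_le ((integrable_const (2 * ρ ^ n)).indicator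
        measurableSet_Ici.compl) (.of_forall hbound)).trans ?_
      rw [integral_indicator_const _ measurableSet_Ici.compl,
        measureReal_compl measurableSet_Ici, probReal_univ, Measure.real, expNN_Ici hν,
        ENNReal.toReal_ofReal (Real.exp_nonneg _), smul_eq_mul, pow_succ]
      have hle : 1 - Real.exp (-((N * r) * s)) ≤ ρ := by
        rw [hρ]
        have : (s : ℝ) ≤ t := hs
        gcongr
      have := pow_nonneg hρ0 n
      nlinarith
  have hlim : Tendsto (fun n : ℕ => 2 * ρ ^ n) atTop (𝓝 0) := by
    simpa using (tendsto_pow_atTop_nhds_zero_of_lt_one hρ0 hρ1).const_mul 2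
  have h0 := ge_of_tendsto' hlim fun n => key n t le_rfl c hc
  exact sub_eq_zero.1 (norm_le_zero_iff.1 h0)

end

/-! ### The free dynamics along a fixed environment -/

/-- The configurations after each of the epochs `τ 1, τ 2, …`, for the relabelling maps `σ`. -/
def trajectory {N d : ℕ} (free : Fin N → ℝ≥0 → EuclideanSpace ℝ (Fin d)) (τ : ℕ → ℝ≥0)
    (σ : ℕ → Fin N → Fin N) (init : Fin N → EuclideanSpace ℝ (Fin d)) :
    ℕ → Fin N → EuclideanSpace ℝ (Fin d)
  | 0 => init
  | q + 1 => fun j => trajectory free τ σ init q (σ q j) +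
      (free (σ q j) (τ (q + 1)) - free (σ q j) (τ q))

/-- The transfer of pair functions along the epochs `τ` and the relabelling maps `σ`. -/
def fixedTransfer {N : ℕ} (θ : ℝ) (τ : ℕ → ℝ≥0) (σ : ℕ → Fin N → Fin N) :
    ℕ → PairFun N →ₗ[ℂ] PairFun N
  | 0 => LinearMap.id
  | q + 1 => (transfer θ (τ (q + 1) - τ q) (σ q)).comp (fixedTransfer θ τ σ q)

lemma trajectory_congr {N d : ℕ} (free : Fin N → ℝ≥0 → EuclideanSpace ℝ (Fin d))
    {τ τ' : ℕ → ℝ≥0} {σ σ' : ℕ → Fin N → Fin N} (init : Fin N → EuclideanSpace ℝ (Fin d)) {n : ℕ}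
    (hτ : ∀ q ≤ n, τ q = τ' q) (hσ : ∀ q < n, σ q = σ' q) :
    trajectory free τ σ init n = trajectory free τ' σ' init n := by
  induction n with
  | zero => rfl
  | succ n ih =>
    have := ih (fun q hq => hτ q (by omega)) fun q hq => hσ q (by omega)
    simp only [trajectory, this, hτ n (by omega), hτ (n + 1) le_rfl, hσ n (by omega)]

lemma fixedTransfer_congr {N : ℕ} {θ : ℝ} {τ τ' : ℕ → ℝ≥0} {σ σ' : ℕ → Fin N → Fin N} {n : ℕ}
    (hτ : ∀ q ≤ n, τ q = τ' q) (hσ : ∀ q < n, σ q = σ' q) :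
    fixedTransfer θ τ σ n = fixedTransfer θ τ' σ' n := by
  induction n with
  | zero => rfl
  | succ n ih =>
    have := ih (fun q hq => hτ q (by omega)) fun q hq => hσ q (by omega)
    simp only [fixedTransfer, this, hτ n (by omega), hτ (n + 1) le_rfl, hσ n (by omega)]

/-- Passing to real variables evaluated at `1` allows increments to be tested in different
directions within a single characteristic function. -/
lemma charFun_map_inner {Ω E : Type*} [MeasurableSpace Ω] {P : Measure Ω} [NormedAddCommGroup E]
    [InnerProductSpace ℝ E] [MeasurableSpace E] [BorelSpace E] [SecondCountableTopology E]
    {X : Ω → E} (hX : AEMeasurable X P) (v : E) :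
    charFun (P.map fun ω => inner ℝ (X ω) v) 1 = charFun (P.map X) v := by
  have h1 : AEMeasurable (fun ω => inner ℝ (X ω) v) P := by fun_prop
  rw [charFun_apply_real, charFun_apply, integral_map h1 (by fun_prop),
    integral_map hX (by fun_prop)]
  simp

lemma comap_le_comap_of_eq_comp {Ω β γ : Type*} [MeasurableSpace β] [MeasurableSpace γ]
    {f : Ω → β} {g : β → γ} {Z : Ω → γ} (hg : Measurable g) (hZ : Z = g ∘ f) :
    MeasurableSpace.comap Z inferInstance ≤ MeasurableSpace.comap f inferInstance := by
  rw [hZ, ← MeasurableSpace.comap_comp]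
  exact MeasurableSpace.comap_mono hg.comap_le

lemma charFun_map_sum_one {Ω ι : Type*} [MeasurableSpace Ω] {P : Measure Ω} {Z : ι → Ω → ℝ}
    (hZm : ∀ x, Measurable (Z x)) (hZ : iIndepFun Z P) (s : Finset ι) :
    charFun (P.map fun ω => ∑ x ∈ s, Z x ω) 1 = ∏ x ∈ s, charFun (P.map (Z x)) 1 := by
  have h := iIndepFun.charFun_map_fun_finsetSum_eq_prod (s := s)
    (fun x _ => (hZm x).aemeasurable) (hZ.restrict s)
  rw [h, Finset.prod_apply]

section

variable {N d : ℕ} {ρ : EuclideanSpace ℝ (Fin d) → ℂ} {m : ℝ} {Ω : Type*} [MeasurableSpace Ω]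
  {P : Measure Ω}

lemma MarkovSymmetricModel.charFun_increment (S : MarkovSymmetricModel N ρ m P)
    (i : Fin N) {s t : ℝ≥0} (hst : s ≤ t)
    (v : EuclideanSpace ℝ (Fin d)) :
    charFun (P.map fun ω => S.free i t ω - S.free i s ω) v =
      Complex.exp (((t - s : ℝ≥0) : ℝ) * ρ v) := by
  have h := (S.free_levy i).stationary_increments s (t - s)
  rw [add_tsub_cancel_of_le hst] at h
  rw [h, S.free_exponent i]

/-- A characteristic function equals `1` at the origin; hence components with weight zero drop out
of products. -/
lemma MarkovSymmetricModel.exp_mul_zero [IsProbabilityMeasure P] (S : MarkovSymmetricModel N ρ m P)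
    (hN : 2 ≤ N) (s : ℝ≥0) :
    Complex.exp ((s : ℝ) * ρ 0) = 1 := by
  have hm := (S.free_levy ⟨0, by omega⟩).measurable s
  have := Measure.isProbabilityMeasure_map (μ := P) hm.aemeasurable
  rw [← S.free_exponent ⟨0, by omega⟩, charFun_zero, probReal_univ, Complex.ofReal_one]

/-- The value at `-v` is the conjugate of the value at `v`, so the product is a squared modulus and
only `Re ρ` survives. -/
lemma MarkovSymmetricModel.exp_mul_exp_neg [IsProbabilityMeasure P] (S : MarkovSymmetricModel N ρ m P)
    (hN : 2 ≤ N) (s : ℝ≥0)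
    (v : EuclideanSpace ℝ (Fin d)) :
    Complex.exp ((s : ℝ) * ρ v) * Complex.exp ((s : ℝ) * ρ (-v)) =
      (Real.exp (-(eta ρ v * s)) : ℝ) := by
  have h := S.free_exponent ⟨0, by omega⟩ s
  rw [← h (-v), charFun_neg, h v, Complex.mul_conj, Complex.normSq_eq_norm_sq,
    Complex.norm_exp, ← Real.exp_nat_mul]
  congr 2
  simp [eta]
  ring

lemma MarkovSymmetricModel.eta_nonneg [IsProbabilityMeasure P] (S : MarkovSymmetricModel N ρ m P)
    (hN : 2 ≤ N) (v : EuclideanSpace ℝ (Fin d)) :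
    0 ≤ eta ρ v := by
  obtain ⟨i⟩ : Nonempty (Fin N) := ⟨⟨0, by omega⟩⟩
  have hm := (S.free_levy i).measurable 1
  have := Measure.isProbabilityMeasure_map (μ := P) hm.aemeasurable
  have h := norm_charFun_le_one (μ := P.map (S.free i 1)) v
  rw [S.free_exponent i, Complex.norm_exp, Real.exp_le_one_iff] at h
  simp only [NNReal.coe_one, Complex.ofReal_one, one_mul] at h
  unfold eta
  linarith

lemma MarkovSymmetricModel.charFun_sum_increments (S : MarkovSymmetricModel N ρ m P)
    (i : Fin N) {τ : ℕ → ℝ≥0} (hτ : Monotone τ) (M : ℕ) (w : ℕ → EuclideanSpace ℝ (Fin d)) :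
    charFun (P.map fun ω => ∑ p ∈ Finset.range M,
      inner ℝ (S.free i (τ (p + 1)) ω - S.free i (τ p) ω) (w p)) 1 =
    ∏ p ∈ Finset.range M, Complex.exp (((τ (p + 1) - τ p : ℝ≥0) : ℝ) * ρ (w p)) := by
  have hfree : ∀ t, Measurable (S.free i t) := (S.free_levy i).measurable
  have hind : iIndepFun (fun (p : ℕ) ω =>
      inner ℝ (S.free i (τ (p + 1)) ω - S.free i (τ p) ω) (w p)) P :=
    ((S.free_levy i).indep_increments.nat hτ).comp (fun p x => inner ℝ x (w p))
      fun p => by fun_prop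
  rw [charFun_map_sum_one (by fun_prop) hind]
  refine Finset.prod_congr rfl fun p _ => ?_
  rw [charFun_map_inner (X := fun ω => S.free i (τ (p + 1)) ω - S.free i (τ p) ω)
    (by fun_prop), S.charFun_increment i (hτ (Nat.le_succ p))]

/-- The joint characteristic function of the initial difference and of the increments. -/
lemma MarkovSymmetricModel.charFun_init_add_increments [IsProbabilityMeasure P] (S : MarkovSymmetricModel N ρ m P)
    {τ : ℕ → ℝ≥0} (hτ : Monotone τ) (M : ℕ)
    (w : Fin N → ℕ → EuclideanSpace ℝ (Fin d)) (v : EuclideanSpace ℝ (Fin d)) (j k : Fin N) :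
    charFun (P.map fun ω => inner ℝ (S.init ω j - S.init ω k) v + ∑ i, ∑ p ∈ Finset.range M,
      inner ℝ (S.free i (τ (p + 1)) ω - S.free i (τ p) ω) (w i p)) 1 =
    charFun (P.map fun ω => S.init ω j - S.init ω k) v *
      ∏ i, ∏ p ∈ Finset.range M, Complex.exp (((τ (p + 1) - τ p : ℝ≥0) : ℝ) * ρ (w i p)) := by
  have hfree : ∀ i t, Measurable (S.free i t) := fun i => (S.free_levy i).measurable
  have hinit := S.init_measurable
  -- `none` stands for the initial configuration and `some i` for the free motion of `i`; these come
  -- from distinct independent sources.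
  let Z : Option (Fin N) → Ω → ℝ := fun x ω => match x with
    | none => inner ℝ (S.init ω j - S.init ω k) v
    | some i => ∑ p ∈ Finset.range M,
        inner ℝ (S.free i (τ (p + 1)) ω - S.free i (τ p) ω) (w i p)
  have hZm : ∀ x, Measurable (Z x) := by
    rintro (_ | i)
    · simp only [Z]; fun_prop
    · simp only [Z]; fun_prop
  let g : Option (Fin N) → Source N := fun x => match x with
    | none => Source.init
    | some i => Source.free i
  have hg : Function.Injective g := by
    rintro (_ | i) (_ | i') h <;> simp_all [g]
  have hZ : iIndepFun Z P := by
    rw [iIndepFun_iff_iIndep]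
    refine iIndep_of_iIndep_of_le (S.independent.precomp hg) ?_
    rintro (_ | i)
    · exact comap_le_comap_of_eq_comp (f := S.init) (g := fun x => inner ℝ (x j - x k) v)
        (by fun_prop) rfl
    · exact comap_le_comap_of_eq_comp (f := fun ω (t : ℝ≥0) => S.free i t ω)
        (g := fun x => ∑ p ∈ Finset.range M, inner ℝ (x (τ (p + 1)) - x (τ p)) (w i p))
        (by fun_prop) rfl
  have hsum : (fun ω => inner ℝ (S.init ω j - S.init ω k) v + ∑ i, ∑ p ∈ Finset.range M,
      inner ℝ (S.free i (τ (p + 1)) ω - S.free i (τ p) ω) (w i p)) = fun ω => ∑ x, Z x ω := by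
    funext ω
    rw [Fintype.sum_option]
  have h0 : charFun (P.map (Z none)) 1 = charFun (P.map fun ω => S.init ω j - S.init ω k) v :=
    charFun_map_inner (X := fun ω => S.init ω j - S.init ω k) (by fun_prop) v
  have h1 : ∀ i, charFun (P.map (Z (some i))) 1 =
      ∏ p ∈ Finset.range M, Complex.exp (((τ (p + 1) - τ p : ℝ≥0) : ℝ) * ρ (w i p)) :=
    fun i => S.charFun_sum_increments i hτ M (w i)
  have h2 := charFun_map_sum_one hZm hZ Finset.univ
  clear_value Z
  rw [hsum, h2, Fintype.prod_option, h0]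
  simp only [h1]

/-- If the lineages coincide, the weights `v` and `-v` cancel; otherwise two independent increments
contribute opposite weights. This is the damping factor in `transfer`. -/
lemma MarkovSymmetricModel.prod_exp_pair [IsProbabilityMeasure P] (S : MarkovSymmetricModel N ρ m P)
    (hN : 2 ≤ N) (s : ℝ≥0) (v : EuclideanSpace ℝ (Fin d))
    (j k : Fin N) :
    ∏ i, Complex.exp ((s : ℝ) * ρ ((if i = j then v else 0) - if i = k then v else 0)) =
      if j = k then 1 else ((Real.exp (-(eta ρ v * s)) : ℝ) : ℂ) := by
  split_ifs with hjk
  · subst hjk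
    simp [S.exp_mul_zero hN]
  · rw [← S.exp_mul_exp_neg hN, Finset.prod_eq_mul j k hjk]
    · simp [hjk, Ne.symm hjk]
    · intro i _ hi
      simp [hi.1, hi.2, S.exp_mul_zero hN]
    · simp
    · simp

/-- The joint characteristic function of a difference at the `q`-th epoch and of the later
increments. -/
lemma MarkovSymmetricModel.charFun_trajectory_add_increments [IsProbabilityMeasure P] (S : MarkovSymmetricModel N ρ m P)
    (hN : 2 ≤ N) {τ : ℕ → ℝ≥0}
    (hτ : Monotone τ) (σ : ℕ → Fin N → Fin N) (v : EuclideanSpace ℝ (Fin d)) (M q : ℕ) (hq : q ≤ M)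
    (w : Fin N → ℕ → EuclideanSpace ℝ (Fin d)) (hw : ∀ i, ∀ p < q, w i p = 0) (j k : Fin N) :
    charFun (P.map fun ω =>
      inner ℝ (trajectory (fun i s => S.free i s ω) τ σ (S.init ω) q j -
        trajectory (fun i s => S.free i s ω) τ σ (S.init ω) q k) v +
      ∑ i, ∑ p ∈ Finset.range M,
        inner ℝ (S.free i (τ (p + 1)) ω - S.free i (τ p) ω) (w i p)) 1 =
    fixedTransfer (eta ρ v) τ σ q
        (fun p => charFun (P.map fun ω => S.init ω p.1 - S.init ω p.2) v) (j, k) *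
      ∏ i, ∏ p ∈ Finset.range M, Complex.exp (((τ (p + 1) - τ p : ℝ≥0) : ℝ) * ρ (w i p)) := by
  induction q generalizing w j k with
  | zero => exact S.charFun_init_add_increments hτ M w v j k
  | succ q ih =>
    let u : Fin N → EuclideanSpace ℝ (Fin d) := fun i =>
      (if i = σ q j then v else 0) - if i = σ q k then v else 0
    have hqM : q ∈ Finset.range M := Finset.mem_range.2 hq
    -- The increments over the `q`-th interval are absorbed into the weights, which is possible
    -- because `w` vanishes there. This is why the statement carries arbitrary weights on later
    -- increments.
    have hih := ih (by omega) (fun i => Function.update (w i) q (u i)) (fun i p hp => by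
      rw [Function.update_of_ne hp.ne]; exact hw i p (by omega)) (σ q j) (σ q k)
    have hsplit : ∀ (i : Fin N) ω, ∑ p ∈ Finset.range M,
        inner ℝ (S.free i (τ (p + 1)) ω - S.free i (τ p) ω) (Function.update (w i) q (u i) p) =
        inner ℝ (S.free i (τ (q + 1)) ω - S.free i (τ q) ω) (u i) + ∑ p ∈ Finset.range M,
        inner ℝ (S.free i (τ (p + 1)) ω - S.free i (τ p) ω) (w i p) := by
      intro i ω
      rw [← Finset.add_sum_erase _ _ hqM, Function.update_self]
      congr 1
      rw [← Finset.add_sum_erase (Finset.range M) (fun p =>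
        inner ℝ (S.free i (τ (p + 1)) ω - S.free i (τ p) ω) (w i p)) hqM,
        hw i q (by omega), inner_zero_right, zero_add]
      exact Finset.sum_congr rfl fun p hp => by
        rw [Function.update_of_ne (Finset.ne_of_mem_erase hp)]
    have hprod : ∀ i : Fin N, ∏ p ∈ Finset.range M,
        Complex.exp (((τ (p + 1) - τ p : ℝ≥0) : ℝ) * ρ (Function.update (w i) q (u i) p)) =
        Complex.exp (((τ (q + 1) - τ q : ℝ≥0) : ℝ) * ρ (u i)) * ∏ p ∈ Finset.range M,
        Complex.exp (((τ (p + 1) - τ p : ℝ≥0) : ℝ) * ρ (w i p)) := by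
      intro i
      rw [← Finset.mul_prod_erase _ _ hqM, Function.update_self]
      congr 1
      rw [← Finset.mul_prod_erase (Finset.range M) (fun p =>
        Complex.exp (((τ (p + 1) - τ p : ℝ≥0) : ℝ) * ρ (w i p))) hqM,
        hw i q (by omega), S.exp_mul_zero hN, one_mul]
      exact Finset.prod_congr rfl fun p hp => by
        rw [Function.update_of_ne (Finset.ne_of_mem_erase hp)]
    have hu : ∀ ω, ∑ i, inner ℝ (S.free i (τ (q + 1)) ω - S.free i (τ q) ω) (u i) =
        inner ℝ (S.free (σ q j) (τ (q + 1)) ω - S.free (σ q j) (τ q) ω) v -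
        inner ℝ (S.free (σ q k) (τ (q + 1)) ω - S.free (σ q k) (τ q) ω) v := by
      intro ω
      simp only [u, inner_sub_right, Finset.sum_sub_distrib, apply_ite (inner ℝ _),
        inner_zero_right, Finset.sum_ite_eq', Finset.mem_univ, if_true]
    simp only [hsplit, hprod, Finset.sum_add_distrib, Finset.prod_mul_distrib] at hih
    simp only [u] at hu hih
    rw [S.prod_exp_pair hN] at hih
    simp only [hu] at hih
    have hfun : ∀ ω, inner ℝ (trajectory (fun i s => S.free i s ω) τ σ (S.init ω) (q + 1) j -
          trajectory (fun i s => S.free i s ω) τ σ (S.init ω) (q + 1) k) v =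
        inner ℝ (trajectory (fun i s => S.free i s ω) τ σ (S.init ω) q (σ q j) -
          trajectory (fun i s => S.free i s ω) τ σ (S.init ω) q (σ q k)) v +
        (inner ℝ (S.free (σ q j) (τ (q + 1)) ω - S.free (σ q j) (τ q) ω) v -
        inner ℝ (S.free (σ q k) (τ (q + 1)) ω - S.free (σ q k) (τ q) ω) v) := by
      intro ω
      rw [← inner_sub_left, ← inner_add_left]
      congr 1
      simp only [trajectory]
      abel
    simp only [hfun, add_assoc]
    rw [hih, fixedTransfer, LinearMap.comp_apply, transfer_apply]
    ring

lemma MarkovSymmetricModel.measurable_trajectory (S : MarkovSymmetricModel N ρ m P)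
    {τ : ℕ → ℝ≥0} (σ : ℕ → Fin N → Fin N) (q : ℕ)
    (j : Fin N) :
    Measurable fun ω => trajectory (fun i s => S.free i s ω) τ σ (S.init ω) q j := by
  have hfree : ∀ i t, Measurable (S.free i t) := fun i => (S.free_levy i).measurable
  have hinit := S.init_measurable
  induction q generalizing j with
  | zero => simp only [trajectory]; fun_prop
  | succ q ih =>
    simp only [trajectory]
    exact (ih _).add ((hfree _ _).sub (hfree _ _))

lemma MarkovSymmetricModel.charFun_trajectory [IsProbabilityMeasure P] (S : MarkovSymmetricModel N ρ m P)
    (hN : 2 ≤ N) {τ : ℕ → ℝ≥0}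
    (hτ : Monotone τ) (σ : ℕ → Fin N → Fin N) (v : EuclideanSpace ℝ (Fin d)) (q : ℕ)
    (j k : Fin N) :
    charFun (P.map fun ω => trajectory (fun i s => S.free i s ω) τ σ (S.init ω) q j -
        trajectory (fun i s => S.free i s ω) τ σ (S.init ω) q k) v =
    fixedTransfer (eta ρ v) τ σ q
        (fun p => charFun (P.map fun ω => S.init ω p.1 - S.init ω p.2) v) (j, k) := by
  have h := S.charFun_trajectory_add_increments hN hτ σ v q q le_rfl (fun _ _ => 0)
    (fun _ _ _ => rfl) j k
  simp only [inner_zero_right, Finset.sum_const_zero, add_zero, S.exp_mul_zero hN,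
    Finset.prod_const_one, mul_one] at h
  rw [← h, charFun_map_inner]
  exact ((S.measurable_trajectory σ q j).sub (S.measurable_trajectory σ q k)).aemeasurable

/-- By exchangeability all differences of the initial configuration have the same law. -/
lemma MarkovSymmetricModel.charFun_init_sub [IsProbabilityMeasure P] (S : MarkovSymmetricModel N ρ m P)
    (v : EuclideanSpace ℝ (Fin d)) {j k : Fin N}
    (hjk : j ≠ k) :
    (fun p : Fin N × Fin N => charFun (P.map fun ω => S.init ω p.1 - S.init ω p.2) v) =
      offDiagFun N (charFun (P.map fun ω => S.init ω j - S.init ω k) v) := by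
  have hinit := S.init_measurable
  funext p
  by_cases hp : p.1 = p.2
  · simp [offDiagFun, hp, charFun_apply]
  · simp only [offDiagFun, hp, if_false]
    set k' := Equiv.swap j p.1 k with hk'
    have hk1 : p.1 ≠ k' := by
      rw [hk']
      intro h
      exact hjk ((Equiv.swap j p.1).injective ((Equiv.swap_apply_left j p.1).trans h))
    -- The first swap takes `j` to `p.1` and `k` to `k'`; the second takes `k'` to `p.2` and fixes
    -- `p.1`, which differs from both.
    let π : Equiv.Perm (Fin N) := (Equiv.swap j p.1).trans (Equiv.swap k' p.2)
    have h1 : π j = p.1 := by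
      simp only [π, Equiv.trans_apply, Equiv.swap_apply_left]
      exact Equiv.swap_apply_of_ne_of_ne hk1 hp
    have h2 : π k = p.2 := by
      simp only [π, Equiv.trans_apply, ← hk', Equiv.swap_apply_left]
    have hsub : Measurable fun x : Fin N → EuclideanSpace ℝ (Fin d) => x j - x k := by fun_prop
    have h := congrArg (Measure.map fun x : Fin N → EuclideanSpace ℝ (Fin d) => x j - x k)
      (S.init_exchangeable π)
    rw [Measure.map_map hsub (by fun_prop), Measure.map_map hsub hinit] at h
    have h3 : (fun x : Fin N → EuclideanSpace ℝ (Fin d) => x j - x k) ∘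
        (fun ω i => S.init ω (π i)) = fun ω => S.init ω p.1 - S.init ω p.2 := by
      funext ω
      simp [h1, h2]
    rw [h3] at h
    rw [h]
    rfl

end

/-! ### The configuration as a function of the environment and of the free paths. -/

section

variable {N d : ℕ} [NeZero N]

lemma IsRegular.afterSync_eq {e : Env N} (h : IsRegular e)
    (free : Fin N → ℝ≥0 → EuclideanSpace ℝ (Fin d)) (init : Fin N → EuclideanSpace ℝ (Fin d))
    (q : ℕ) :
    afterSync free (fun k n => (e k n).1) (fun k n => (e k n).2) init q =
      trajectory free (fun q => envEpoch q e) (fun q => redirect (firstPair (nextEnv^[q] e)))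
        init q := by
  induction q with
  | zero => rfl
  | succ q ih =>
    simp only [afterSync, trajectory, ih, h.syncMap_eq, h.epoch_eq]

/-- The configuration at time `t` as a function of the environment. -/
def envConfig (free : Fin N → ℝ≥0 → EuclideanSpace ℝ (Fin d)) (e : Env N)
    (init : Fin N → EuclideanSpace ℝ (Fin d)) (t : ℝ≥0) (j : Fin N) : EuclideanSpace ℝ (Fin d) :=
  trajectory free (fun q => envEpoch q e) (fun q => redirect (firstPair (nextEnv^[q] e)))
    init (envLast e t) j + (free j t - free j (envEpoch (envLast e t) e))

lemma IsRegular.configuration_eq {e : Env N} (h : IsRegular e)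
    (free : Fin N → ℝ≥0 → EuclideanSpace ℝ (Fin d)) (init : Fin N → EuclideanSpace ℝ (Fin d))
    (t : ℝ≥0) (j : Fin N) :
    configuration free (fun k n => (e k n).1) (fun k n => (e k n).2) init t j =
      envConfig free e init t j := by
  rw [configuration, envConfig, h.lastSync_eq, h.afterSync_eq, h.epoch_eq]

lemma fixedTransfer_envEpoch (θ : ℝ) (e : Env N) (q : ℕ) :
    fixedTransfer θ (fun q => envEpoch q e) (fun q => redirect (firstPair (nextEnv^[q] e))) q =
      envTransfer θ q e := by
  induction q with
  | zero => rfl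
  | succ q ih =>
    rw [fixedTransfer, ih, envTransfer, envEpoch_succ, add_tsub_cancel_left]

variable {ρ : EuclideanSpace ℝ (Fin d) → ℂ} {m : ℝ} {Ω : Type*} [MeasurableSpace Ω]
  {P : Measure Ω}

/-- The characteristic function of a difference, for a fixed environment. -/
lemma MarkovSymmetricModel.charFun_envConfig [IsProbabilityMeasure P] (S : MarkovSymmetricModel N ρ m P)
    (hN : 2 ≤ N) {e : Env N} (he : IsRegular e) (t : ℝ≥0)
    (v : EuclideanSpace ℝ (Fin d)) {j k : Fin N} (hjk : j ≠ k) :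
    charFun (P.map fun ω => envConfig (fun i s => S.free i s ω) e (S.init ω) t j -
      envConfig (fun i s => S.free i s ω) e (S.init ω) t k) v =
    envFlow (eta ρ v) e t
      (offDiagFun N (charFun (P.map fun ω => S.init ω j - S.init ω k) v)) (j, k) := by
  set L := envLast e t with hL
  -- The observation time is added as an artificial epoch `L + 1` with identity relabelling, so the
  -- state at `t` is itself a term of a trajectory.
  let τ : ℕ → ℝ≥0 := fun q => if q ≤ L then envEpoch q e else t
  let σ : ℕ → Fin N → Fin N := fun q =>
    if q < L then redirect (firstPair (nextEnv^[q] e)) else id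
  have hτ : Monotone τ := by
    refine monotone_nat_of_le_succ fun q => ?_
    simp only [τ]
    split_ifs with h1 h2 h2
    · exact he.strictMono.monotone (Nat.le_succ q)
    · have : q = L := by omega
      rw [this]
      exact he.envEpoch_envLast_le t
    · omega
    · exact le_rfl
  have hτL : ∀ q ≤ L, τ q = envEpoch q e := fun q hq => if_pos hq
  have hσL : ∀ q < L, σ q = redirect (firstPair (nextEnv^[q] e)) := fun q hq => if_pos hq
  have hτ1 : τ (L + 1) = t := if_neg (by omega)
  have hσ1 : σ L = id := if_neg (by omega)
  have htraj : ∀ ω i, envConfig (fun i s => S.free i s ω) e (S.init ω) t i =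
      trajectory (fun i s => S.free i s ω) τ σ (S.init ω) (L + 1) i := by
    intro ω i
    rw [envConfig, ← hL, trajectory, hτ1, hσ1, hτL L le_rfl, trajectory_congr _ _ hτL hσL]
    rfl
  simp only [htraj]
  rw [S.charFun_trajectory hN hτ, fixedTransfer, hτ1, hσ1, hτL L le_rfl,
    fixedTransfer_congr hτL hσL, fixedTransfer_envEpoch, S.charFun_init_sub v hjk]
  rfl

end

/-! ### Jointly measurable evaluation of right-continuous paths -/

/-- A sequence of times with countably many values, decreasing to `t` from the right. -/
def rightApprox (n : ℕ) (t : ℝ≥0) : ℝ≥0 := ((⌊t * (n + 1)⌋₊ : ℝ≥0) + 1) / (n + 1)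

lemma lt_rightApprox (n : ℕ) (t : ℝ≥0) : t < rightApprox n t := by
  rw [rightApprox, lt_div_iff₀ (by positivity)]
  exact Nat.lt_floor_add_one _

lemma rightApprox_le (n : ℕ) (t : ℝ≥0) : rightApprox n t ≤ t + 1 / (n + 1) := by
  rw [rightApprox, div_le_iff₀ (by positivity), add_mul, div_mul_cancel₀ _ (by positivity)]
  gcongr
  exact Nat.floor_le zero_le

lemma tendsto_rightApprox (t : ℝ≥0) :
    Tendsto (fun n => rightApprox n t) atTop (𝓝[Set.Ici t] t) := by
  refine tendsto_nhdsWithin_iff.2 ⟨?_, .of_forall fun n => (lt_rightApprox n t).le⟩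
  have h : Tendsto (fun n : ℕ => t + 1 / ((n : ℝ≥0) + 1)) atTop (𝓝 (t + 0)) :=
    tendsto_const_nhds.add (tendsto_one_div_add_atTop_nhds_zero_nat (𝕜 := ℝ≥0))
  rw [add_zero] at h
  exact tendsto_of_tendsto_of_tendsto_of_le_of_le tendsto_const_nhds h
    (fun n => (lt_rightApprox n t).le) fun n => rightApprox_le n t

/-- The right limit of a path along `rightApprox`. -/
def rightEval {E : Type*} [TopologicalSpace E] [Nonempty E] (x : ℝ≥0 → E) (t : ℝ≥0) : E :=
  limUnder atTop fun n => x (rightApprox n t)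

lemma rightEval_eq {E : Type*} [TopologicalSpace E] [T2Space E] [Nonempty E] {x : ℝ≥0 → E}
    {t : ℝ≥0} (h : ContinuousWithinAt x (Set.Ici t) t) : rightEval x t = x t :=
  (h.tendsto.comp (tendsto_rightApprox t)).limUnder_eq

/-- Evaluation at a variable time need not be measurable for the product `σ`-algebra on paths. Each
approximation reads the path only on a countable grid, and limits preserve measurability. -/
lemma measurable_rightEval {d : ℕ} : Measurable
    fun p : (ℝ≥0 → EuclideanSpace ℝ (Fin d)) × ℝ≥0 => rightEval p.1 p.2 := by
  refine (StronglyMeasurable.limUnder (l := atTop) fun n => ?_).measurable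
  refine Measurable.stronglyMeasurable ?_
  exact measurable_eval_index
    (f := fun (k : ℕ) (p : (ℝ≥0 → EuclideanSpace ℝ (Fin d)) × ℝ≥0) =>
      p.1 (((k : ℝ≥0) + 1) / (n + 1)))
    (i := fun p => ⌊p.2 * (n + 1)⌋₊) (fun k => by fun_prop)
    (Nat.measurable_floor.comp (by fun_prop))

/-! ### The laws of the environment and of the free dynamics -/

section

variable {N d : ℕ} {ρ : EuclideanSpace ℝ (Fin d) → ℂ} {m : ℝ} {Ω : Type*} [mΩ : MeasurableSpace Ω]
  {P : Measure Ω}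

/-- The environment of the model. -/
def MarkovSymmetricModel.env (S : MarkovSymmetricModel N ρ m P) (ω : Ω) : Env N :=
  fun k n => (S.gap k n ω, S.recip k n ω)

/-- The free paths and the initial configuration. -/
abbrev FreeData (N d : ℕ) : Type :=
  (Fin N → ℝ≥0 → EuclideanSpace ℝ (Fin d)) × (Fin N → EuclideanSpace ℝ (Fin d))

/-- The free paths and the initial configuration of the model. -/
def MarkovSymmetricModel.freeData (S : MarkovSymmetricModel N ρ m P) (ω : Ω) : FreeData N d :=
  (fun j t => S.free j t ω, S.init ω)

lemma MarkovSymmetricModel.measurable_env (S : MarkovSymmetricModel N ρ m P) :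
    Measurable S.env :=
  measurable_pi_iff.2 fun k => measurable_pi_iff.2 fun n =>
    (S.gap_measurable k n).prodMk (S.recip_measurable k n)

lemma MarkovSymmetricModel.measurable_freeData (S : MarkovSymmetricModel N ρ m P) :
    Measurable S.freeData :=
  (measurable_pi_iff.2 fun j => measurable_pi_iff.2 fun t =>
    (S.free_levy j).measurable t).prodMk S.init_measurable

lemma MarkovSymmetricModel.sourceSigma_le (S : MarkovSymmetricModel N ρ m P) (s : Source N) :
    sourceSigma S.free S.gap S.recip S.init s ≤ mΩ := by
  cases s with
  | free j => exact (measurable_pi_iff.2 fun t => (S.free_levy j).measurable t).comap_le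
  | gap k n => exact (S.gap_measurable k n).comap_le
  | recip k n => exact (S.recip_measurable k n).comap_le
  | init => exact S.init_measurable.comap_le

lemma MarkovSymmetricModel.indepFun_env_freeData (S : MarkovSymmetricModel N ρ m P) :
    IndepFun S.env S.freeData P := by
  let A : Set (Source N) := {s | ∃ k n, s = .gap k n ∨ s = .recip k n}
  let B : Set (Source N) := {s | (∃ j, s = .free j) ∨ s = .init}
  have hAB : Disjoint A B := by
    refine Set.disjoint_left.2 ?_
    rintro s ⟨k, n, rfl | rfl⟩ (⟨j, h⟩ | h) <;> cases h
  rw [IndepFun_iff_Indep]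
  refine indep_of_indep_of_le (indep_iSup_of_disjoint S.sourceSigma_le S.independent hAB) ?_ ?_
  · have hle : ∀ s ∈ A, sourceSigma S.free S.gap S.recip S.init s ≤
        ⨆ i ∈ A, sourceSigma S.free S.gap S.recip S.init i := fun s hs =>
      le_iSup₂ (f := fun i (_ : i ∈ A) => sourceSigma S.free S.gap S.recip S.init i) s hs
    refine measurable_iff_comap_le.1 ?_
    refine @measurable_pi_lambda _ _ _ (_) _ _ fun k => @measurable_pi_lambda _ _ _ (_) _ _
      fun n => @Measurable.prodMk _ _ _ _ _ (_) _ _ ?_ ?_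
    · exact measurable_iff_comap_le.2 (hle (.gap k n) ⟨k, n, .inl rfl⟩)
    · exact measurable_iff_comap_le.2 (hle (.recip k n) ⟨k, n, .inr rfl⟩)
  · have hle : ∀ s ∈ B, sourceSigma S.free S.gap S.recip S.init s ≤
        ⨆ i ∈ B, sourceSigma S.free S.gap S.recip S.init i := fun s hs =>
      le_iSup₂ (f := fun i (_ : i ∈ B) => sourceSigma S.free S.gap S.recip S.init i) s hs
    refine measurable_iff_comap_le.1 (@Measurable.prodMk _ _ _ _ _ (_) _ _ ?_ ?_)
    · refine @measurable_pi_lambda _ _ _ (_) _ _ fun j => ?_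
      exact measurable_iff_comap_le.2 (hle (.free j) (.inl ⟨j, rfl⟩))
    · exact measurable_iff_comap_le.2 (hle .init (.inr rfl))

lemma MarkovSymmetricModel.map_gap (S : MarkovSymmetricModel N ρ m P) (k : Fin N) (n : ℕ) :
    P.map (S.gap k n) = expNN m⁻¹ := by
  have hm := S.gap_measurable k n
  rw [expNN, ← S.gap_law k n, Measure.map_map (by fun_prop) (by fun_prop)]
  congr 1
  funext ω
  simp

lemma MarkovSymmetricModel.map_recip [IsProbabilityMeasure P] (S : MarkovSymmetricModel N ρ m P)
    (hN : 2 ≤ N) (k : Fin N) (n : ℕ) : P.map (S.recip k n) = unifNe k := by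
  have hm := S.recip_measurable k n
  have := isProbabilityMeasure_unifNe hN k
  have := Measure.isProbabilityMeasure_map (μ := P) hm.aemeasurable
  have hne : ∀ j, j ≠ k → P.map (S.recip k n) {j} = unifNe k {j} := by
    intro j hj
    have h1 : unifNe k {j} = (N - 1 : ℝ≥0∞)⁻¹ := by
      have := lintegral_unifNe k (Set.indicator {j} 1)
      rw [lintegral_indicator_one (measurableSet_singleton j),
        Finset.sum_eq_single_of_mem j (Finset.mem_erase.2 ⟨hj, Finset.mem_univ _⟩)] at this
      · simpa using this
      · intro i _ hi
        simp [hi]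
    have h2 := S.recip_law k n j hj
    have h3 : P.map (S.recip k n) {j} = P {ω | S.recip k n ω = j} :=
      Measure.map_apply hm (measurableSet_singleton j)
    rw [h3, h1, ← ENNReal.ofReal_toReal (measure_ne_top P _)]
    change ENNReal.ofReal (P.real _) = _
    have h4 : (0 : ℝ) < N - 1 := by
      have : (2 : ℝ) ≤ N := by exact_mod_cast hN
      linarith
    rw [h2, one_div, ENNReal.ofReal_inv_of_pos h4, ENNReal.ofReal_sub _ zero_le_one]
    simp
  -- `recip_law` says nothing about the sender itself; its mass is the complement of the others.
  have hk : P.map (S.recip k n) {k} = unifNe k {k} := by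
    have hsplit : ∀ μ : Measure (Fin N), IsProbabilityMeasure μ →
        μ {k} = 1 - ∑ j ∈ Finset.univ.erase k, μ {j} := by
      intro μ hμ
      rw [sum_measure_singleton, Finset.coe_erase, Finset.coe_univ, ← Set.compl_eq_univ_sdiff,
        prob_compl_eq_one_sub (measurableSet_singleton k),
        ENNReal.sub_sub_cancel ENNReal.one_ne_top prob_le_one]
    rw [hsplit _ inferInstance, hsplit _ inferInstance,
      Finset.sum_congr rfl fun j hj => hne j (Finset.ne_of_mem_erase hj)]
  refine Measure.ext_of_singleton fun j => ?_
  by_cases hj : j = k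
  · rw [hj, hk]
  · exact hne j hj

lemma MarkovSymmetricModel.map_mark [IsProbabilityMeasure P] (S : MarkovSymmetricModel N ρ m P)
    (hN : 2 ≤ N) (k : Fin N) (n : ℕ) :
    P.map (fun ω => (S.gap k n ω, S.recip k n ω)) = markLaw m⁻¹ k := by
  have h : IndepFun (S.gap k n) (S.recip k n) P := by
    rw [IndepFun_iff_Indep]
    exact S.independent.indep (i := .gap k n) (j := .recip k n) (by simp)
  rw [h.map_prod_eq_prod_map_map (S.gap_measurable k n).aemeasurable
    (S.recip_measurable k n).aemeasurable, S.map_gap, S.map_recip hN, markLaw]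

/-- Interval and recipient are separate independent sources. Grouping them into marks is checked on
the `π`-system of measurable rectangles, where the probability factorises. -/
lemma MarkovSymmetricModel.iIndepFun_mark [IsProbabilityMeasure P]
    (S : MarkovSymmetricModel N ρ m P) :
    iIndepFun (fun (p : Fin N × ℕ) ω => (S.gap p.1 p.2 ω, S.recip p.1 p.2 ω)) P := by
  classical
  let g : (Fin N × ℕ) × Bool → Source N := fun x =>
    if x.2 then .gap x.1.1 x.1.2 else .recip x.1.1 x.1.2
  have hg : Function.Injective g := by
    rintro ⟨⟨k, n⟩, _ | _⟩ ⟨⟨k', n'⟩, _ | _⟩ h <;> simp_all [g]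
  have hind := S.independent.precomp hg
  let π : Fin N × ℕ → Set (Set Ω) := fun p =>
    Set.preimage (fun ω => (S.gap p.1 p.2 ω, S.recip p.1 p.2 ω)) ''
      Set.image2 (· ×ˢ ·) {s | MeasurableSet s} {t | MeasurableSet t}
  rw [iIndepFun_iff_iIndep]
  refine iIndepSets.iIndep (fun p => ((S.gap_measurable p.1 p.2).prodMk
    (S.recip_measurable p.1 p.2)).comap_le) π (fun p => isPiSystem_prod.comap _) (fun p => ?_) ?_
  · rw [← generateFrom_prod, MeasurableSpace.comap_generateFrom]
  · rw [iIndepSets_iff]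
    intro s f hf
    have hf' : ∀ p, ∃ A : Bool → Set Ω, (p ∈ s → f p = A true ∩ A false) ∧
        ∀ b, MeasurableSet[(sourceSigma S.free S.gap S.recip S.init ∘ g) (p, b)] (A b) := by
      intro p
      by_cases hp : p ∈ s
      · obtain ⟨_, ⟨a, ha, b, hb, rfl⟩, h⟩ := hf p hp
        refine ⟨fun x => if x then S.gap p.1 p.2 ⁻¹' a else S.recip p.1 p.2 ⁻¹' b,
          fun _ => ?_, ?_⟩
        · rw [← h]
          rfl
        · rintro (_ | _)
          · exact ⟨b, hb, rfl⟩
          · exact ⟨a, ha, rfl⟩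
      · exact ⟨fun _ => ∅, fun h => absurd h hp,
          fun b => @MeasurableSet.empty _ (_)⟩
    choose A hA hAm using hf'
    have h1 : ∀ s : Finset (Fin N × ℕ), P (⋂ p ∈ s, A p true ∩ A p false) =
        ∏ p ∈ s, P (A p true) * P (A p false) := by
      intro s
      have h := hind.meas_biInter (S := s ×ˢ Finset.univ) (s := fun x => A x.1 x.2)
        fun x _ => hAm x.1 x.2
      rw [Finset.prod_product] at h
      simp only [Fintype.prod_bool] at h
      rw [← h]
      congr 1
      ext ω
      simp only [Set.mem_iInter, Set.mem_inter_iff, Finset.mem_product, Finset.mem_univ, and_true]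
      refine ⟨fun h x hx => ?_, fun h p hp => ⟨h (p, true) hp, h (p, false) hp⟩⟩
      obtain ⟨p, _ | _⟩ := x
      · exact (h p hx).2
      · exact (h p hx).1
    have h2 : ∀ p, P (A p true ∩ A p false) = P (A p true) * P (A p false) := by
      intro p
      simpa using h1 {p}
    have h3 : ⋂ p ∈ s, f p = ⋂ p ∈ s, A p true ∩ A p false :=
      Set.iInter₂_congr fun p hp => hA p hp
    rw [h3, h1]
    exact Finset.prod_congr rfl fun p hp => by rw [hA p hp, h2]

lemma MarkovSymmetricModel.map_env [IsProbabilityMeasure P] (S : MarkovSymmetricModel N ρ m P)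
    (hN : 2 ≤ N) (hm : 0 < m) : P.map S.env = envLaw N m⁻¹ := by
  have := isProbabilityMeasure_markLaw hN (inv_pos.2 hm)
  have := isProbabilityMeasure_seqLaw hN (inv_pos.2 hm)
  have hmark : ∀ p : Fin N × ℕ, Measurable fun ω => (S.gap p.1 p.2 ω, S.recip p.1 p.2 ω) :=
    fun p => (S.gap_measurable _ _).prodMk (S.recip_measurable _ _)
  have h := (iIndepFun_iff_map_fun_eq_infinitePi_map hmark).1 S.iIndepFun_mark
  simp only [S.map_mark hN] at h
  have h2 := Measure.infinitePi_map_curry (fun (k : Fin N) (_ : ℕ) => markLaw m⁻¹ k)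
  rw [← h, Measure.map_map (by fun_prop) (by fun_prop), Measure.infinitePi_eq_pi] at h2
  exact h2

/-- Conditioning on the environment. -/
lemma MarkovSymmetricModel.charFun_map_env_freeData [IsProbabilityMeasure P]
    (S : MarkovSymmetricModel N ρ m P) (hN : 2 ≤ N) (hm : 0 < m)
    {Ψ : Env N × FreeData N d → EuclideanSpace ℝ (Fin d)} (hΨ : Measurable Ψ)
    (v : EuclideanSpace ℝ (Fin d)) :
    charFun (P.map fun ω => Ψ (S.env ω, S.freeData ω)) v =
      ∫ e, charFun (P.map fun ω => Ψ (e, S.freeData ω)) v ∂envLaw N m⁻¹ := by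
  have henv := S.measurable_env
  have hfree := S.measurable_freeData
  have hprod := S.indepFun_env_freeData.map_prod_eq_prod_map_map henv.aemeasurable
    hfree.aemeasurable
  rw [S.map_env hN hm] at hprod
  have := isProbabilityMeasure_envLaw hN (inv_pos.2 hm)
  have := Measure.isProbabilityMeasure_map (μ := P) hfree.aemeasurable
  have hF : Measurable fun y : Env N × FreeData N d =>
      Complex.exp (inner ℝ (Ψ y) v * Complex.I) := by fun_prop
  have hint : Integrable (fun y : Env N × FreeData N d =>
      Complex.exp (inner ℝ (Ψ y) v * Complex.I)) ((envLaw N m⁻¹).prod (P.map S.freeData)) :=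
    .of_bound hF.aestronglyMeasurable 1 (.of_forall fun y => by
      rw [Complex.norm_exp_ofReal_mul_I])
  rw [charFun_apply, integral_map (by fun_prop) (by fun_prop),
    ← integral_map (φ := fun ω => (S.env ω, S.freeData ω))
      (f := fun y => Complex.exp (inner ℝ (Ψ y) v * Complex.I)) (by fun_prop)
      hF.aestronglyMeasurable, hprod, integral_prod _ hint]
  refine integral_congr_ae (.of_forall fun e => ?_)
  have hΨe : Measurable fun y => Ψ (e, y) := hΨ.comp measurable_prodMk_left
  have hFe : Measurable fun y => Complex.exp (inner ℝ (Ψ (e, y)) v * Complex.I) :=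
    hF.comp measurable_prodMk_left
  simp only
  rw [charFun_apply, integral_map (φ := fun ω => Ψ (e, S.freeData ω))
    (hΨe.comp hfree).aemeasurable (by fun_prop),
    integral_map hfree.aemeasurable hFe.aestronglyMeasurable]

lemma measurable_rightEval_freeData {X : Type*} [MeasurableSpace X] {y : X → FreeData N d}
    {t : X → ℝ≥0} (hy : Measurable y) (ht : Measurable t) (i : Fin N) :
    Measurable fun x => rightEval ((y x).1 i) (t x) :=
  measurable_rightEval.comp (((measurable_pi_apply i).comp hy.fst).prodMk ht)

lemma MarkovSymmetricModel.ae_rightEval [IsProbabilityMeasure P]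
    (S : MarkovSymmetricModel N ρ m P) :
    ∀ᵐ ω ∂P, (fun i s => rightEval ((S.freeData ω).1 i) s) = fun i s => S.free i s ω := by
  filter_upwards [ae_all_iff.2 fun i => (S.free_levy i).cadlag] with ω hω
  funext i s
  exact rightEval_eq (hω i s).1

end

/-! ### The characteristic function of a difference at time `t`. -/

section

variable {N d : ℕ} [NeZero N]

lemma measurable_trajectory_env (q : ℕ) (j : Fin N) :
    Measurable fun y : Env N × FreeData N d => trajectory (fun i s => rightEval (y.2.1 i) s)
      (fun q => envEpoch q y.1) (fun q => redirect (firstPair (nextEnv^[q] y.1))) y.2.2 q j := by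
  induction q generalizing j with
  | zero => simp only [trajectory]; fun_prop
  | succ q ih =>
    simp only [trajectory]
    have hpair : Measurable fun y : Env N × FreeData N d => firstPair (nextEnv^[q] y.1) :=
      measurable_firstPair.comp ((measurable_nextEnv.iterate q).comp measurable_fst)
    refine measurable_eval_index (f := fun u (y : Env N × FreeData N d) =>
      trajectory (fun i s => rightEval (y.2.1 i) s)
        (fun q => envEpoch q y.1) (fun q => redirect (firstPair (nextEnv^[q] y.1))) y.2.2 q
        (redirect u j) + (rightEval (y.2.1 (redirect u j)) (envEpoch (q + 1) y.1) -
          rightEval (y.2.1 (redirect u j)) (envEpoch q y.1))) (fun u => ?_) hpair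
    exact (ih _).add ((measurable_rightEval_freeData measurable_snd
      ((measurable_envEpoch _).comp measurable_fst) _).sub
      (measurable_rightEval_freeData measurable_snd
      ((measurable_envEpoch _).comp measurable_fst) _))

lemma measurable_envConfig (t : ℝ≥0) (j : Fin N) :
    Measurable fun y : Env N × FreeData N d =>
      envConfig (fun i s => rightEval (y.2.1 i) s) y.1 y.2.2 t j := by
  simp only [envConfig]
  have hlast : Measurable fun y : Env N × FreeData N d => envLast y.1 t :=
    measurable_envLast.comp (measurable_fst.prodMk measurable_const)
  refine measurable_eval_index (f := fun q (y : Env N × FreeData N d) =>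
      trajectory (fun i s => rightEval (y.2.1 i) s)
        (fun q => envEpoch q y.1) (fun q => redirect (firstPair (nextEnv^[q] y.1))) y.2.2 q j +
      (rightEval (y.2.1 j) t - rightEval (y.2.1 j) (envEpoch q y.1))) (fun q => ?_) hlast
  exact (measurable_trajectory_env q j).add ((measurable_rightEval_freeData measurable_snd
      measurable_const _).sub (measurable_rightEval_freeData measurable_snd
      ((measurable_envEpoch _).comp measurable_fst) _))

variable {ρ : EuclideanSpace ℝ (Fin d) → ℂ} {m : ℝ} {Ω : Type*} [MeasurableSpace Ω]
  {P : Measure Ω} [IsProbabilityMeasure P]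

/-- Almost sure regularity and right-continuity replace the state by a jointly measurable function
of environment and free data, to which Fubini applies. -/
lemma MarkovSymmetricModel.state_ae_eq (S : MarkovSymmetricModel N ρ m P) (hN : 2 ≤ N)
    (hm : 0 < m) (j : Fin N) (t : ℝ≥0) : S.state j t =ᵐ[P] fun ω =>
      envConfig (fun i s => rightEval ((S.freeData ω).1 i) s) (S.env ω) (S.freeData ω).2 t j := by
  have hreg : ∀ᵐ ω ∂P, IsRegular (S.env ω) := by
    have := ae_isRegular hN (inv_pos.2 hm)
    rw [← S.map_env hN hm] at this
    exact ae_of_ae_map S.measurable_env.aemeasurable this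
  filter_upwards [hreg, S.ae_rightEval] with ω h1 h2
  rw [h2]
  exact h1.configuration_eq (fun i s => S.free i s ω) (S.init ω) t j

lemma MarkovSymmetricModel.aemeasurable_state (S : MarkovSymmetricModel N ρ m P) (hN : 2 ≤ N)
    (hm : 0 < m) (j : Fin N) (t : ℝ≥0) : AEMeasurable (S.state j t) P :=
  ⟨_, (measurable_envConfig t j).comp (S.measurable_env.prodMk S.measurable_freeData),
    S.state_ae_eq hN hm j t⟩

/-- The characteristic function of a difference at time `t`. -/
lemma MarkovSymmetricModel.charFun_state_sub (S : MarkovSymmetricModel N ρ m P) (hN : 2 ≤ N)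
    (hm : 0 < m) {j k : Fin N} (hjk : j ≠ k) (t : ℝ≥0) (v : EuclideanSpace ℝ (Fin d)) :
    charFun (P.map fun ω => S.state j t ω - S.state k t ω) v =
      mergeCurve (mergeProb N * (N * m⁻¹)) (eta ρ v)
        (charFun (P.map fun ω => S.init ω j - S.init ω k) v) t := by
  have hinit := S.init_measurable
  let Ψ : Env N × FreeData N d → EuclideanSpace ℝ (Fin d) := fun y =>
    envConfig (fun i s => rightEval (y.2.1 i) s) y.1 y.2.2 t j -
      envConfig (fun i s => rightEval (y.2.1 i) s) y.1 y.2.2 t k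
  have hΨ : Measurable Ψ := (measurable_envConfig t j).sub (measurable_envConfig t k)
  have h1 : (fun ω => S.state j t ω - S.state k t ω) =ᵐ[P] fun ω =>
      Ψ (S.env ω, S.freeData ω) := (S.state_ae_eq hN hm j t).sub (S.state_ae_eq hN hm k t)
  have := Measure.isProbabilityMeasure_map (μ := P)
    (f := fun ω => S.init ω j - S.init ω k) (by fun_prop)
  rw [Measure.map_congr h1, S.charFun_map_env_freeData hN hm hΨ,
    ← meanFlow_eq (p := (j, k)) hN (inv_pos.2 hm) (S.eta_nonneg hN v)
      (norm_charFun_le_one v) hjk, meanFlow]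
  refine integral_congr_ae ?_
  filter_upwards [ae_isRegular hN (inv_pos.2 hm)] with e he
  rw [← S.charFun_envConfig hN he t v hjk]
  congr 1
  refine Measure.map_congr ?_
  filter_upwards [S.ae_rightEval] with ω hω
  simp only [Ψ, hω]
  rfl

/-! ### The limit law -/

lemma integral_exp_neg_expNN {r a : ℝ} (hr : 0 < r) (ha : 0 ≤ a) :
    ∫ s : ℝ≥0, ((Real.exp (-(a * s)) : ℝ) : ℂ) ∂expNN r = ((r / (r + a) : ℝ) : ℂ) := by
  rw [integral_complex_ofReal, integral_eq_lintegral_of_nonneg_ae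
    (.of_forall fun s => Real.exp_nonneg _) (by fun_prop), lintegral_exp_neg_expNN hr ha,
    ENNReal.toReal_ofReal (by positivity)]

/-- The limit law of the differences. -/
lemma MarkovSymmetricModel.exists_limit_law (S : MarkovSymmetricModel N ρ m P) (hN : 2 ≤ N)
    (hm : 0 < m) : ∃ L : Measure (EuclideanSpace ℝ (Fin d)), IsProbabilityMeasure L ∧
      ∀ v, charFun L v = ((1 / (1 + (N - 1) * m / 2 * eta ρ v) : ℝ) : ℂ) := by
  have hN' : (2 : ℝ) ≤ N := by exact_mod_cast hN
  let j : Fin N := ⟨0, by omega⟩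
  let k : Fin N := ⟨1, by omega⟩
  have hjk : j ≠ k := by simp [j, k]
  -- `firstTime` is exponential with mean `m / N`, so `b * firstTime` has mean `(N - 1) m / 2`, the
  -- mean merging time. It is independent of the free motion, hence can serve as the random
  -- duration.
  let b : ℝ≥0 := (N : ℝ≥0) * ((N - 1 : ℕ) : ℝ≥0) / 2
  have hb : (b : ℝ) = N * (N - 1) / 2 := by
    simp only [b]
    rw [NNReal.coe_div, NNReal.coe_mul, NNReal.coe_natCast, NNReal.coe_natCast,
      Nat.cast_sub (by omega : 1 ≤ N), Nat.cast_one, NNReal.coe_ofNat]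
  let Ψ : Env N × FreeData N d → EuclideanSpace ℝ (Fin d) := fun y =>
    (rightEval (y.2.1 j) (b * firstTime y.1) - rightEval (y.2.1 j) 0) -
      (rightEval (y.2.1 k) (b * firstTime y.1) - rightEval (y.2.1 k) 0)
  have hT : Measurable fun y : Env N × FreeData N d => b * firstTime y.1 :=
    measurable_const.mul (measurable_firstTime.comp measurable_fst)
  have hΨ : Measurable Ψ :=
    ((measurable_rightEval_freeData measurable_snd hT j).sub
      (measurable_rightEval_freeData measurable_snd measurable_const j)).sub
    ((measurable_rightEval_freeData measurable_snd hT k).sub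
      (measurable_rightEval_freeData measurable_snd measurable_const k))
  have hmeas : Measurable fun ω => Ψ (S.env ω, S.freeData ω) :=
    hΨ.comp (S.measurable_env.prodMk S.measurable_freeData)
  refine ⟨P.map fun ω => Ψ (S.env ω, S.freeData ω),
    Measure.isProbabilityMeasure_map hmeas.aemeasurable, fun v => ?_⟩
  have hη := S.eta_nonneg hN v
  have hinner : ∀ e, charFun (P.map fun ω => Ψ (e, S.freeData ω)) v =
      ((Real.exp (-(eta ρ v * b * firstTime e)) : ℝ) : ℂ) := by
    intro e
    let τ : ℕ → ℝ≥0 := fun q => if q = 0 then 0 else b * firstTime e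
    have hτ : Monotone τ := monotone_nat_of_le_succ fun q => by
      cases q <;> simp [τ]
    let w : Fin N → ℕ → EuclideanSpace ℝ (Fin d) := fun i _ =>
      (if i = j then v else 0) - if i = k then v else 0
    -- The initial difference is tested in direction `0` and disappears; only one increment, over
    -- `[0, b * firstTime e]`, remains.
    have h := S.charFun_init_add_increments hτ 1 w 0 j k
    have hinit := S.init_measurable
    have := Measure.isProbabilityMeasure_map (μ := P)
      (f := fun ω => S.init ω j - S.init ω k) (by fun_prop)
    simp only [inner_zero_right, zero_add, Finset.sum_range_one, Finset.prod_range_one,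
      charFun_zero, probReal_univ, Complex.ofReal_one, one_mul, w, τ, if_true, one_ne_zero,
      if_false, tsub_zero] at h
    rw [S.prod_exp_pair hN, if_neg hjk] at h
    have hu : ∀ ω, ∑ i, inner ℝ (S.free i (b * firstTime e) ω - S.free i 0 ω)
        ((if i = j then v else 0) - if i = k then v else 0) =
        inner ℝ ((S.free j (b * firstTime e) ω - S.free j 0 ω) -
          (S.free k (b * firstTime e) ω - S.free k 0 ω)) v := by
      intro ω
      simp only [inner_sub_right, Finset.sum_sub_distrib, apply_ite (inner ℝ _),
        inner_zero_right, Finset.sum_ite_eq', Finset.mem_univ, if_true]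
      rw [← inner_sub_left]
    simp only [hu] at h
    have hfree : ∀ i t, Measurable (S.free i t) := fun i => (S.free_levy i).measurable
    rw [charFun_map_inner (X := fun ω => (S.free j (b * firstTime e) ω - S.free j 0 ω) -
          (S.free k (b * firstTime e) ω - S.free k 0 ω)) (by fun_prop)] at h
    rw [NNReal.coe_mul, ← mul_assoc] at h
    rw [← h]
    congr 1
    refine Measure.map_congr ?_
    filter_upwards [S.ae_rightEval] with ω hω
    have hω' : ∀ i s, rightEval ((S.freeData ω).1 i) s = S.free i s ω := fun i s =>
      congrFun (congrFun hω i) s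
    simp only [Ψ, hω']
  rw [S.charFun_map_env_freeData hN hm hΨ]
  simp only [hinner]
  have hν : 0 < N * m⁻¹ := by positivity
  rw [← integral_map (μ := envLaw N m⁻¹) (φ := firstTime) measurable_firstTime.aemeasurable
      (f := fun s : ℝ≥0 => ((Real.exp (-(eta ρ v * b * s)) : ℝ) : ℂ)) (by fun_prop),
    (measurePreserving_firstTime hN (inv_pos.2 hm)).map_eq,
    integral_exp_neg_expNN hν (mul_nonneg hη b.coe_nonneg), hb]
  congr 1
  have h0 : N * m⁻¹ + eta ρ v * (N * (N - 1) / 2) ≠ 0 := by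
    have : 0 ≤ eta ρ v * (N * (N - 1) / 2) := mul_nonneg hη (by nlinarith)
    positivity
  have h1 : 1 + (N - 1) * m / 2 * eta ρ v ≠ 0 := by
    have : 0 ≤ (N - 1) * m / 2 * eta ρ v := mul_nonneg (by nlinarith) hη
    positivity
  rw [div_eq_div_iff h0 h1]
  field_simp

end

/-! ### Convergence in law -/

lemma tendsto_mergeCurve {κ θ : ℝ} (h : 0 < κ + θ) (c : ℂ) :
    Tendsto (fun t : ℝ≥0 => mergeCurve κ θ c t) atTop (𝓝 ((κ / (κ + θ) : ℝ) : ℂ)) := by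
  have h1 : Tendsto (fun t : ℝ≥0 => Real.exp (-((κ + θ) * t))) atTop (𝓝 0) :=
    Real.tendsto_exp_neg_atTop_nhds_zero.comp
      ((NNReal.tendsto_coe_atTop.2 tendsto_id).const_mul_atTop h)
  have h2 := ((Complex.continuous_ofReal.tendsto 0).comp h1).const_mul
    (c - ((κ / (κ + θ) : ℝ) : ℂ))
  have h3 := h2.const_add ((κ / (κ + θ) : ℝ) : ℂ)
  simp only [Complex.ofReal_zero, mul_zero, add_zero] at h3
  refine h3.congr fun t => ?_
  simp [mergeCurve]

/-- Weak convergence along a countably generated filter follows from pointwise convergence of the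
characteristic functions. -/
lemma tendsto_probabilityMeasure_of_tendsto_charFun {ι : Type*} {l : Filter ι}
    [l.IsCountablyGenerated] {E : Type*} [NormedAddCommGroup E] [InnerProductSpace ℝ E]
    [FiniteDimensional ℝ E] [MeasurableSpace E] [BorelSpace E] {μ : ι → ProbabilityMeasure E}
    {ν : ProbabilityMeasure E}
    (h : ∀ v : E, Tendsto (fun i => charFun (μ i : Measure E) v) l (𝓝 (charFun ν v))) :
    Tendsto μ l (𝓝 ν) :=
  tendsto_of_seq_tendsto fun _ hx =>
    ProbabilityMeasure.tendsto_of_tendsto_charFun fun v => (h v).comp hx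

/-- The modulus of the characteristic function of a stable law. -/
lemma IsStableLaw.norm_charFun_pow {d : ℕ} {α : ℝ} {μ : Measure (EuclideanSpace ℝ (Fin d))}
    [IsProbabilityMeasure μ] (h : IsStableLaw α μ) {n : ℕ} (hn : 1 ≤ n)
    (v : EuclideanSpace ℝ (Fin d)) :
    ‖charFun μ v‖ ^ n = ‖charFun μ ((n : ℝ) ^ (1 / α) • v)‖ := by
  obtain ⟨D, hD⟩ := h
  have h1 : charFun ((Measure.pi (fun _ : Fin n => μ)).map (fun u => ∑ i, u i)) v =
      charFun μ v ^ n := by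
    rw [charFun_apply, integral_map (by fun_prop) (by fun_prop)]
    simp only [sum_inner, Complex.ofReal_sum, Finset.sum_mul, Complex.exp_sum]
    rw [integral_fintype_prod_eq_prod (fun (_ : Fin n) (x : EuclideanSpace ℝ (Fin d)) =>
      Complex.exp (inner ℝ x v * Complex.I))]
    simp [charFun_apply]
  have h2 : μ.map (fun u => (n : ℝ) ^ (1 / α) • u + D n) =
      (μ.map ((n : ℝ) ^ (1 / α) • ·)).map (· + D n) := by
    rw [Measure.map_map (by fun_prop) (by fun_prop)]
    rfl
  -- Taking moduli removes the phase produced by the translation `D n`.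
  have h3 := congrArg norm h1
  rw [hD n hn, h2, charFun_map_add_const, charFun_map_smul, norm_mul,
    Complex.norm_exp_ofReal_mul_I, mul_one, norm_pow] at h3
  exact h3.symm

section

variable {N d : ℕ} {ρ : EuclideanSpace ℝ (Fin d) → ℂ} {m : ℝ} {Ω : Type*} [MeasurableSpace Ω]
  {P : Measure Ω} [IsProbabilityMeasure P]

/-- The scaling property of `η` for stable free dynamics. -/
lemma MarkovSymmetricModel.eta_smul {α : ℝ} (S : MarkovSymmetricModel N ρ m P) (j : Fin N)
    (hS : IsStableProcess α (S.free j) P) {n : ℕ} (hn : 1 ≤ n)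
    (v : EuclideanSpace ℝ (Fin d)) : eta ρ ((n : ℝ) ^ (1 / α) • v) = n * eta ρ v := by
  have := Measure.isProbabilityMeasure_map (μ := P) ((S.free_levy j).measurable 1).aemeasurable
  have h := (hS 1).norm_charFun_pow hn v
  rw [S.free_exponent j 1, S.free_exponent j 1, Complex.norm_exp, Complex.norm_exp,
    ← Real.exp_nat_mul] at h
  have h' := Real.exp_injective h
  simp only [NNReal.coe_one, Complex.ofReal_one, one_mul] at h'
  simp only [eta, ← h']
  ring

/-- The differences converge in law. -/
lemma MarkovSymmetricModel.tendstoInDistribution_state_sub (S : MarkovSymmetricModel N ρ m P)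
    (hN : 2 ≤ N) (hm : 0 < m) {j k : Fin N} (hjk : j ≠ k)
    {L : Measure (EuclideanSpace ℝ (Fin d))} [IsProbabilityMeasure L]
    (hL : ∀ v, charFun L v = ((1 / (1 + (N - 1) * m / 2 * eta ρ v) : ℝ) : ℂ)) :
    TendstoInDistribution (fun (t : ℝ≥0) ω => S.state j t ω - S.state k t ω) atTop
      (id : EuclideanSpace ℝ (Fin d) → EuclideanSpace ℝ (Fin d)) (fun _ => P) L := by
  have : NeZero N := ⟨by omega⟩
  refine ⟨fun t => (S.aemeasurable_state hN hm j t).sub (S.aemeasurable_state hN hm k t),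
    aemeasurable_id, tendsto_probabilityMeasure_of_tendsto_charFun fun v => ?_⟩
  simp only [ProbabilityMeasure.coe_mk, Measure.map_id, hL]
  have hN' : (2 : ℝ) ≤ N := by exact_mod_cast hN
  have hη := S.eta_nonneg hN v
  -- The merging rate: total message rate times the probability that a message joins the given pair.
  have hκ : mergeProb N * (N * m⁻¹) = 2 / ((N - 1) * m) := by
    rw [mergeProb]
    field_simp
  have hκ0 : 0 < 2 / ((N - 1) * m) := div_pos two_pos (mul_pos (by linarith) hm)
  have hlim : 2 / ((N - 1) * m) / (2 / ((N - 1) * m) + eta ρ v) =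
      1 / (1 + (N - 1) * m / 2 * eta ρ v) := by
    have h0 : (0 : ℝ) < N - 1 := by linarith
    have h1 : 0 < 1 + (N - 1) * m / 2 * eta ρ v := by positivity
    rw [div_eq_div_iff (by positivity) h1.ne']
    field_simp
  rw [← hlim]
  refine (tendsto_mergeCurve (by positivity)
    (charFun (P.map fun ω => S.init ω j - S.init ω k) v)).congr fun t => ?_
  rw [← hκ]
  exact (S.charFun_state_sub hN hm hjk t v).symm

/-- The rescaled limit law has a characteristic function independent of `N`. -/
lemma MarkovSymmetricModel.charFun_rescaled {α : ℝ} (S : MarkovSymmetricModel N ρ m P)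
    (hN : 2 ≤ N) (hS : ∀ j, IsStableProcess α (S.free j) P)
    {L : Measure (EuclideanSpace ℝ (Fin d))}
    (hL : ∀ v, charFun L v = ((1 / (1 + (N - 1) * m / 2 * eta ρ v) : ℝ) : ℂ))
    (v : EuclideanSpace ℝ (Fin d)) :
    charFun (L.map fun y => (((N : ℝ) - 1) ^ (1 / α))⁻¹ • y) v =
      ((1 / (1 + 1 / 2 * m * eta ρ v) : ℝ) : ℂ) := by
  have hN' : (0 : ℝ) < N - 1 := by
    have : (2 : ℝ) ≤ N := by exact_mod_cast hN
    linarith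
  -- Scaling with `n = N - 1` at the shrunken vector gives `η(v) = (N - 1) η((N - 1)^(-1/α) v)`,
  -- which absorbs the factor `N - 1` in the limit law.
  have h := S.eta_smul ⟨0, by omega⟩ (hS _) (n := N - 1) (by omega)
    ((((N : ℝ) - 1) ^ (1 / α))⁻¹ • v)
  rw [Nat.cast_sub (by omega : 1 ≤ N), Nat.cast_one,
    smul_inv_smul₀ (Real.rpow_pos_of_pos hN' _).ne'] at h
  rw [charFun_map_smul, hL, h]
  congr 3
  ring

end

end SyncSystem

end

theorem mainTheorem5 (d : ℕ) (α : ℝ) (hα : 0 < α) (hα2 : α ≤ 2) (m : ℝ) (hm : 0 < m)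
    (ρ : EuclideanSpace ℝ (Fin d) → ℂ) :
    ∃ Q : Measure (EuclideanSpace ℝ (Fin d)), IsProbabilityMeasure Q ∧
      ∀ (N : ℕ), 2 ≤ N →
      ∀ (Ω : Type*) [MeasurableSpace Ω] (P : Measure Ω) [IsProbabilityMeasure P]
        (S : SyncSystem.MarkovSymmetricModel N ρ m P),
        (∀ j, SyncSystem.IsStableProcess α (S.free j) P) →
        (∀ lam : EuclideanSpace ℝ (Fin d),
          charFun Q lam = (((1 / (1 + 1 / 2 * m * SyncSystem.eta ρ lam) : ℝ)) : ℂ)) ∧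
        ∀ j k : Fin N, j ≠ k →
          ∃ (L : Measure (EuclideanSpace ℝ (Fin d))) (_ : IsProbabilityMeasure L),
            TendstoInDistribution (fun (t : ℝ≥0) ω => S.state j t ω - S.state k t ω) atTop
              (id : EuclideanSpace ℝ (Fin d) → EuclideanSpace ℝ (Fin d)) (fun _ => P) L ∧
            L.map (fun y => (((N : ℝ) - 1) ^ (1 / α))⁻¹ • y) = Q := by
  -- `Q` has to be fixed before `N` and the model. If the candidate function is not a characteristic
  -- function, no stable model with exponent `ρ` exists: its rescaled limit law would be such a `Q`.
  -- Any probability measure then serves.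
  by_cases hQ : ∃ Q : Measure (EuclideanSpace ℝ (Fin d)), IsProbabilityMeasure Q ∧
      ∀ lam, charFun Q lam = (((1 / (1 + 1 / 2 * m * SyncSystem.eta ρ lam) : ℝ)) : ℂ)
  · obtain ⟨Q, hQp, hQc⟩ := hQ
    refine ⟨Q, hQp, fun N hN Ω _ P _ S hS => ⟨hQc, fun j k hjk => ?_⟩⟩
    have : NeZero N := ⟨by omega⟩
    obtain ⟨L, hLp, hL⟩ := S.exists_limit_law hN hm
    refine ⟨L, hLp, S.tendstoInDistribution_state_sub hN hm hjk hL, ?_⟩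
    have := Measure.isProbabilityMeasure_map (μ := L)
      (f := fun y => (((N : ℝ) - 1) ^ (1 / α))⁻¹ • y) (by fun_prop)
    exact Measure.ext_of_charFun (funext fun v => by rw [S.charFun_rescaled hN hS hL, hQc])
  · refine ⟨Measure.dirac 0, inferInstance, fun N hN Ω _ P _ S hS => (hQ ?_).elim⟩
    have : NeZero N := ⟨by omega⟩
    obtain ⟨L, hLp, hL⟩ := S.exists_limit_law hN hm
    exact ⟨_, Measure.isProbabilityMeasure_map (by fun_prop), S.charFun_rescaled hN hS hL⟩
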